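/- Let $K$ be a complete discrete valuation field of characteristic $p>0$ with perfect residue field, let $\Omega$ be a separable closure of $K$, and let $G_K=\mathrm{Gal}(\Omega/K)$, with its classical upper ramification filtration $(G_K^r)_{r\in\mathbb{Q}_{>0}}$. For a real number $s\ge 0$ let $G_K^{s+}=\overline{\bigcup_{r\in\mathbb{Q},\,r>s}G_K^r}$; the wild inertia subgroup is $P_K=G_K^{0+}$. Let $\ell\neq p$ be a prime. An $\ell$-adic representation of $G_K$ is a finite-dimensional representation over $\overline{\mathbb{Q}}_\ell$ that comes from a continuous finite-dimensional representation over a finite extension of $\mathbb{Q}_\ell$ contained in $\overline{\mathbb{Q}}_\ell$. Such a representation $M$ has a unique slope decomposition $M=\bigoplus_{r\in\mathbb{Q}_{\ge 0}}M^{(r)}$ into subrepresentations such that $M^{(0)}=M^{P_K}$ and, for all $r>0$, $(M^{(r)})^{G_K^r}=0$ and $G_K^{r+}$ acts trivially on $M^{(r)}$. Its Swan conductor is $\mathrm{Sw}_K(M)=\sum_r r\cdot\dim M^{(r)}$; the Swan conductor of a character is that of the corresponding one-dimensional representation. The same notions are used for every finite separable extension $L$ of $K$ in $\Omega$, with $G_L=\mathrm{Gal}(\Omega/L)$,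 and $M_L$ denotes the restriction of $M$ to $G_L$. Let $M$ be an $\ell$-adic representation of $G_K$ and let $t\ge 0$ be a real number. Suppose that for every totally tamely ramified extension $L/K$ in $\Omega$ of degree $e$ prime to $p$, and every $\ell$-adic character $\chi:G_L\to\overline{\mathbb{Q}}_\ell^\times$ with $\mathrm{Sw}_L(\chi)>et$, one has $$\mathrm{Sw}_L(M_L\otimes\chi)=\mathrm{rk}(M_L)\cdot\mathrm{Sw}_L(\chi).$$ Then $G_K^{t+}$ acts trivially on $M$. -/

import Mathlib

open scoped TensorProduct NNRat

noncomputable section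

namespace LocalRamification

/-! ### Ramification groups

Throughout, `R` is the ring of integers of a complete discrete valuation field `K` with perfect
residue field. For a finite separable extension `F / K` the ring of integers of `F` is the integral
closure of `R` in `F`; it is a local ring, so its maximal ideal is its Jacobson radical. -/

section FiniteLevel

variable (R K F : Type*) [CommRing R] [Field K] [Field F] [Algebra K F] [Algebra R K] [Algebra R F]
  [IsScalarTower R K F]

/-- The maximal ideal of the ring of integers of `F`. -/
def maxIdeal (R F : Type*) [CommRing R] [Field F] [Algebra R F] : Ideal (integralClosure R F) :=
  Ring.jacobson (integralClosure R F)

/-- The lower ramification group `G_i` of `F / K`: the automorphisms `σ` with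
`σ x - x ∈ 𝔪 ^ (i + 1)` for all `x` in the ring of integers of `F`. -/
def lowerGroup (i : ℕ) : Subgroup (F ≃ₐ[K] F) :=
  haveI : SMulCommClass (F ≃ₐ[K] F) R F :=
    ⟨fun σ a x => (σ.restrictScalars R).toLinearMap.map_smul a x⟩
  (maxIdeal R F ^ (i + 1)).inertia (F ≃ₐ[K] F)

/-- The lower ramification group `G_u` of `F / K` for a real number `u ≥ 0`. -/
def lowerGroupReal (u : ℝ) : Subgroup (F ≃ₐ[K] F) :=
  lowerGroup R K F ⌈u⌉₊

/-- The Herbrand function `φ(u) = ∫₀ᵘ dx / [G_0 : G_x]` of `F / K`, for `u ≥ 0`. -/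
def herbrandPhi (u : ℝ) : ℝ :=
  ∫ x in (0 : ℝ)..u,
    (Nat.card (lowerGroupReal R K F x) : ℝ) / (Nat.card (lowerGroup R K F 0) : ℝ)

/-- The inverse `ψ` of the Herbrand function `φ` of `F / K` (which, for `F / K` finite Galois, is an
increasing bijection from the nonnegative real numbers to themselves), evaluated at `v ≥ 0`. -/
def herbrandPsi (v : ℝ) : ℝ :=
  sInf {u : ℝ | 0 ≤ u ∧ v ≤ herbrandPhi R K F u}

/-- The upper ramification group `G^v = G_{ψ(v)}` of the finite Galois extension `F / K`, for
`v ≥ 0`. -/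
def finiteUpperGroup (v : ℝ) : Subgroup (F ≃ₐ[K] F) :=
  lowerGroupReal R K F (herbrandPsi R K F v)

end FiniteLevel

section AbsoluteLevel

variable (R K Ω : Type*) [CommRing R] [Field K] [Field Ω] [Algebra K Ω] [Algebra R K] [Algebra R Ω]
  [IsScalarTower R K Ω]

/-- The classical upper ramification group `G_K^v` of the absolute Galois group
`G_K = Gal(Ω / K)`, where `Ω` is a separable closure of `K`: the automorphisms whose restriction to
every finite Galois subextension `F / K` lies in `Gal(F / K)^v`. Only used for `v > 0`. -/
def upperGroup (v : ℝ) : Subgroup (Ω ≃ₐ[K] Ω) :=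
  ⨅ F : FiniteGaloisIntermediateField K Ω,
    (finiteUpperGroup R K F v).comap (AlgEquiv.restrictNormalHom F)

/-- `G_K^{s+}`, the closure of the union of the `G_K^q` over the rational numbers `q > s`. -/
def upperGroupPlus (s : ℝ) : Set (Ω ≃ₐ[K] Ω) :=
  closure (⋃ q : {q : ℚ // s < (q : ℝ)}, (upperGroup R K Ω ((q : ℚ) : ℝ) : Set (Ω ≃ₐ[K] Ω)))

/-- The wild inertia subgroup `P = G_K^{0+}`. -/
def wildInertia : Set (Ω ≃ₐ[K] Ω) :=
  upperGroupPlus R K Ω 0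

end AbsoluteLevel

/-! ### Representations -/

section Representations

/-- The vectors fixed by a set `H` of group elements. -/
def fixedVectors {k G V : Type*} [Field k] [Group G] [AddCommGroup V] [Module k V]
    (ρ : Representation k G V) (H : Set G) : Submodule k V :=
  ⨅ g ∈ H, LinearMap.eqLocus (ρ g) LinearMap.id

/-- A representation over `ℚ̄_ℓ` is `ℓ`-adic if it comes from a finite-dimensional continuous
representation over a finite extension `E` of `ℚ_ℓ` contained in `ℚ̄_ℓ`: in some finite basis, all
matrix coefficients are `E`-valued and continuous. -/
def IsLAdic (ℓ : ℕ) [Fact ℓ.Prime] {G V : Type*} [Group G] [TopologicalSpace G] [AddCommGroup V]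
    [Module (PadicAlgCl ℓ) V] (ρ : Representation (PadicAlgCl ℓ) G V) : Prop :=
  ∃ E : IntermediateField ℚ_[ℓ] (PadicAlgCl ℓ), FiniteDimensional ℚ_[ℓ] E ∧
    ∃ (n : ℕ) (b : Module.Basis (Fin n) (PadicAlgCl ℓ) V), ∀ i j,
      (∀ g, b.repr (ρ g (b j)) i ∈ E) ∧ Continuous fun g => b.repr (ρ g (b j)) i

/-- The one-dimensional representation attached to a character. -/
def charRep {k G : Type*} [Field k] [Group G] (χ : G →* kˣ) : Representation k G k where
  toFun g := (χ g : k) • LinearMap.id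
  map_one' := by ext; simp
  map_mul' g h := by ext; simp [mul_comm]

end Representations

section Slopes

variable (R : Type*) {K Ω k V : Type*} [CommRing R] [Field K] [Field Ω] [Algebra K Ω] [Algebra R K]
  [Algebra R Ω] [IsScalarTower R K Ω] [Field k] [AddCommGroup V] [Module k V]

/-- `W` is the slope decomposition `V = ⨁_r V^{(r)}` of a representation of `G_K`. -/
structure IsSlopeDecomposition (ρ : Representation k (Ω ≃ₐ[K] Ω) V)
    (W : ℚ≥0 → Submodule k V) : Prop where
  isInternal : DirectSum.IsInternal W
  stable : ∀ r g, ∀ v ∈ W r, ρ g v ∈ W r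
  slope_zero : W 0 = fixedVectors ρ (wildInertia R K Ω)
  fixed_eq_bot : ∀ r, 0 < r → W r ⊓ fixedVectors ρ (upperGroup R K Ω (r : ℝ)) = ⊥
  le_fixed : ∀ r, 0 < r → W r ≤ fixedVectors ρ (upperGroupPlus R K Ω (r : ℝ))

open Classical in
/-- The Swan conductor `∑_r r · dim V^{(r)}` of a representation of `G_K`. (Every `ℓ`-adic
representation has exactly one slope decomposition; the value `0` for a representation without one
is a convention.) -/
def swan (ρ : Representation k (Ω ≃ₐ[K] Ω) V) : ℝ :=
  if h : ∃ W : ℚ≥0 → Submodule k V, IsSlopeDecomposition R ρ W then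
    ∑ᶠ r : ℚ≥0, (r : ℝ) * (Module.finrank k (h.choose r) : ℝ)
  else 0

end Slopes

/-! ### Base change to finite extensions -/

section BaseChange

variable {K Ω k V : Type*} [Field K] [Field Ω] [Algebra K Ω] [Field k] [AddCommGroup V] [Module k V]

/-- The restriction `M_L` to `G_L = Gal(Ω / L)` of a representation `M` of `G_K`. -/
def restrictTo (ρ : Representation k (Ω ≃ₐ[K] Ω) V) (L : IntermediateField K Ω) :
    Representation k (Ω ≃ₐ[L] Ω) V :=
  ρ.comp (AlgEquiv.restrictScalarsHom K)

/-- `L / K` is totally tamely ramified of degree prime to the residue characteristic `p`: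
`L / K` is finite, its ramification index equals its degree `e`, that is `𝔪_K 𝒪_L = 𝔪_L ^ e`,
and `e` is prime to `p`. -/
structure IsTotallyTamelyRamified (R : Type*) [CommRing R] [IsLocalRing R] [Algebra R K]
    [Algebra R Ω] [IsScalarTower R K Ω] (p : ℕ) (L : IntermediateField K Ω) : Prop where
  finite : FiniteDimensional K L
  totally_ramified :
    (IsLocalRing.maximalIdeal R).map (algebraMap R (integralClosure R L)) =
      maxIdeal R L ^ Module.finrank K L
  coprime : (Module.finrank K L).Coprime p

end BaseChange

end LocalRamification

end

/-!
If some element of `G_K^{t+}` acts nontrivially on `M`, then, as the kernel of `M` is closed, so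
does some `g` in `G_K^q` with `q > t` rational. Let `d = dim M`. For a suitable `e` prime to `p`
there are `d + 1` integers `n₀ < ⋯ < n_d` prime to `p` between `e t` and `e q`. Over
`L = K(π^{1/e})` one has `G_K^q ⊆ G_L^{e q}`, and the Artin–Schreier equation
`y ^ p - y = π_L ^ (-n)` gives, for each `n = nᵢ`, a character `χ` of `G_L` with Swan conductor `n`.
The hypothesis says that the slopes of `M_L ⊗ χ` have average `n`. Some slope is larger than `n`,
since `g` acts nontrivially on `M` and trivially through `χ`; hence some slope is smaller than `n`,
and it yields a nonzero vector `uᵢ` on which `G_L^n` acts through `χ⁻¹`. For `i < j` the group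
`G_L^{n_j}` fixes `uᵢ` but acts on the line of `u_j` through a nontrivial character, so
`u₀, …, u_d` are linearly independent, which is absurd in a space of dimension `d`
(`eq_one_of_swan_tprod`, `linearIndependent_of_apply_eq`).

The ramification theory this needs is developed through the depth `λ(s) = v(s ϖ / ϖ - 1)` of an
element of inertia, which is what both filtrations are read off from. The upper numbering is
expressed by `v ≤ φ(λ(s))`, where `φ` is, up to the factor `|I|`, the sum `∑ min(λ(s), ·)`
(`mem_finiteUpperGroup_iff`). Rings of integers need not be treated as monogenic: in characteristic
`p` with perfect residue field, no element of the ring is moved more than a uniformizer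
(`addVal_apply_sub_le`), because every element is a `p ^ n`-th power modulo it. Herbrand's theorem
on quotients follows from an identity for the sum of depths over a coset (`sum_depth_add_one_eq`)
and a combinatorial computation (`le_herbrandSum_iff_exists`); with compactness of the Galois group
it shows that upper ramification groups surject onto those of finite quotients
(`exists_mem_upperGroup_restrict`). The tame base change (`exists_mem_upperGroup_of_tame`) holds
because elements of positive depth fix `π^{1/e}` while the inertia group shrinks by the factor `e`.
The break of the Artin–Schreier extension is computed from the explicit uniformizer
`y ^ (-α) / π ^ β` with `α n = 1 + β p` (`depth_eq_of_artinSchreier`).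
-/

open scoped TensorProduct NNRat

noncomputable section

namespace LocalRamification

/-! ### Finite extensions of complete local rings -/

/-- Finite modules over a precomplete ring are precomplete: adic completion is right exact. -/
theorem isPrecomplete_of_finite {R : Type*} [CommRing R] (I : Ideal R) [IsPrecomplete I R]
    (N : Type*) [AddCommGroup N] [Module R N] [Module.Finite R N] : IsPrecomplete I N := by
  rw [← AdicCompletion.of_surjective_iff]
  intro y
  obtain ⟨z, rfl⟩ := AdicCompletion.ofTensorProduct_surjective_of_finite I N y
  induction z with
  | zero => exact ⟨0, by simp⟩
  | tmul r x =>
    obtain ⟨r, rfl⟩ := AdicCompletion.of_surjective I R r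
    refine ⟨r • x, ?_⟩
    rw [AdicCompletion.ofTensorProduct_tmul, map_smul]
    ext n
    simp
    rfl
  | add a b ha hb =>
    obtain ⟨a', ha⟩ := ha
    obtain ⟨b', hb⟩ := hb
    exact ⟨a' + b', by rw [map_add, map_add, ha, hb]⟩

/-- In an Artinian ring, some power of `a` generates an ideal generated by an idempotent. -/
theorem exists_isIdempotentElem_of_isArtinianRing {A : Type*} [CommRing A] [IsArtinianRing A]
    (a : A) : ∃ (n : ℕ) (b : A), IsIdempotentElem (a * b) ∧ a ^ n * (a * b) = a ^ n := by
  obtain ⟨n, y, hy⟩ := IsArtinian.exists_pow_succ_smul_dvd a (1 : A)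
  simp only [smul_eq_mul, mul_one] at hy
  have key : ∀ k, a ^ n = a ^ n * (a ^ k * y ^ k) := by
    intro k
    induction k with
    | zero => simp
    | succ k ih =>
      calc a ^ n = a ^ n * (a ^ k * y ^ k) := ih
        _ = (a ^ n.succ * y) * (a ^ k * y ^ k) := by rw [hy]
        _ = _ := by rw [Nat.succ_eq_add_one]; ring
  refine ⟨n + 1, a ^ n * y ^ (n + 1), ?_, ?_⟩
  · have h := key (n + 1)
    unfold IsIdempotentElem
    calc a * (a ^ n * y ^ (n + 1)) * (a * (a ^ n * y ^ (n + 1)))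
        = (a ^ n * (a ^ (n + 1) * y ^ (n + 1))) * (a * y ^ (n + 1)) := by ring
      _ = a ^ n * (a * y ^ (n + 1)) := by rw [← h]
      _ = _ := by ring
  · have h := key (n + 1)
    calc a ^ (n + 1) * (a * (a ^ n * y ^ (n + 1)))
        = (a ^ n * (a ^ (n + 1) * y ^ (n + 1))) * a := by ring
      _ = a ^ n * a := by rw [← h]
      _ = _ := by ring

/-- A domain that is a finite algebra over a complete Noetherian local ring is local: idempotents
of the special fibre lift, so the special fibre is a connected Artinian ring. -/
theorem isLocalRing_of_finite_of_isAdicComplete (R S : Type*) [CommRing R] [IsLocalRing R]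
    [IsNoetherianRing R] [IsAdicComplete (IsLocalRing.maximalIdeal R) R] [CommRing S] [IsDomain S]
    [Algebra R S] [Module.Finite R S] : IsLocalRing S := by
  set I := (IsLocalRing.maximalIdeal R).map (algebraMap R S) with hI
  have hpre : IsPrecomplete (IsLocalRing.maximalIdeal R) S := isPrecomplete_of_finite _ S
  have hcomp : IsAdicComplete (IsLocalRing.maximalIdeal R) S := { hpre with }
  have hcompS : IsAdicComplete I S := (IsAdicComplete.map_algebraMap_iff _ _).mpr hcomp
  have hH : HenselianRing S I := inferInstance
  let : Field (R ⧸ IsLocalRing.maximalIdeal R) := Ideal.Quotient.field _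
  let : Algebra (R ⧸ IsLocalRing.maximalIdeal R) (S ⧸ I) :=
    (Ideal.quotientMap I (algebraMap R S) Ideal.le_comap_map).toAlgebra
  have : IsScalarTower R (R ⧸ IsLocalRing.maximalIdeal R) (S ⧸ I) :=
    IsScalarTower.of_algebraMap_eq fun x => rfl
  have : Module.Finite R (S ⧸ I) := inferInstance
  have : Module.Finite (R ⧸ IsLocalRing.maximalIdeal R) (S ⧸ I) :=
    Module.Finite.of_restrictScalars_finite R _ _
  have : IsArtinianRing (S ⧸ I) := IsArtinianRing.of_finite (R ⧸ IsLocalRing.maximalIdeal R) _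
  have hunit : ∀ x : S, IsUnit (Ideal.Quotient.mk I x) → IsUnit x := fun x hx => by
    have := isLocalHom_of_le_jacobson_bot I hH.jac
    exact IsUnit.of_map (Ideal.Quotient.mk I) x hx
  -- Henselian lifting: an idempotent of `S ⧸ I` comes from a root of `X ^ 2 - X` in the domain `S`.
  have hidem : ∀ e : S ⧸ I, IsIdempotentElem e → e = 0 ∨ e = 1 := by
    intro e he
    obtain ⟨e, rfl⟩ := Ideal.Quotient.mk_surjective e
    have he' : e * e - e ∈ I := by
      rw [← Ideal.Quotient.eq, map_mul]; exact he
    obtain ⟨a, ha, hae⟩ := hH.is_henselian (Polynomial.X ^ 2 - Polynomial.X) (by monicity!) e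
      (by simpa [sq] using he') (by
        refine IsUnit.of_mul_eq_one (Ideal.Quotient.mk I (2 * e - 1)) ?_
        rw [← map_mul, ← map_one (Ideal.Quotient.mk I), Ideal.Quotient.eq]
        have : Polynomial.eval e (Polynomial.derivative (Polynomial.X ^ 2 - Polynomial.X))
            * (2 * e - 1) - 1 = 4 * (e * e - e) := by
          simp; ring
        rw [this]
        exact I.mul_mem_left _ he')
    have h2 : a * (a - 1) = 0 := by
      have := ha
      simp only [Polynomial.IsRoot, Polynomial.eval_sub, Polynomial.eval_pow,
        Polynomial.eval_X] at this
      linear_combination this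
    rw [← Ideal.Quotient.eq] at hae
    rcases mul_eq_zero.mp h2 with h | h
    · left; rw [← hae, h, map_zero]
    · right; rw [← hae, sub_eq_zero.mp h, map_one]
  refine IsLocalRing.of_isUnit_or_isUnit_one_sub_self fun a => ?_
  obtain ⟨n, b, hb, hab⟩ := exists_isIdempotentElem_of_isArtinianRing (Ideal.Quotient.mk I a)
  rcases hidem _ hb with h | h
  · right
    apply hunit
    rw [map_sub, map_one]
    rw [h, mul_zero] at hab
    exact IsNilpotent.isUnit_one_sub ⟨n, hab.symm⟩
  · left
    exact hunit _ (IsUnit.of_mul_eq_one _ h)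

/-! ### Inertia acting on a discrete valuation ring -/

section Depth

open IsLocalRing
open IsDiscreteValuationRing hiding maximalIdeal

variable {S : Type*} [CommRing S] [IsDomain S] [IsDiscreteValuationRing S]

theorem mem_maximalIdeal_pow_iff (x : S) (n : ℕ) :
    x ∈ maximalIdeal S ^ n ↔ (n : ℕ∞) ≤ addVal S x := by
  obtain ⟨ϖ, hϖ⟩ := exists_irreducible S
  rw [hϖ.maximalIdeal_eq, Ideal.span_singleton_pow, Ideal.mem_span_singleton,
    ← addVal_le_iff_dvd, addVal_pow, addVal_uniformizer hϖ]
  simp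

theorem mem_maximalIdeal_iff (x : S) : x ∈ maximalIdeal S ↔ 1 ≤ addVal S x := by
  simpa using mem_maximalIdeal_pow_iff x 1

theorem addVal_eq_of_associated {x y : S} (h : Associated x y) : addVal S x = addVal S y :=
  (addVal_eq_iff_associated x y).mpr h

theorem irreducible_of_addVal_eq_one {x : S} (h : addVal S x = 1) : Irreducible x := by
  obtain ⟨ϖ, hϖ⟩ := exists_irreducible S
  rw [← addVal_uniformizer hϖ, addVal_eq_iff_associated] at h
  exact h.symm.irreducible hϖ

/-- The valuation of a sum of two elements, the second of which has larger valuation. -/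
theorem addVal_add_of_dvd {x y c : S} (hc : c ∈ maximalIdeal S) (h : y = x * c) :
    addVal S (x + y) = addVal S x := by
  subst h
  apply addVal_eq_of_associated
  have : IsUnit (1 + c) := by
    by_contra hn
    have h1 : (1 + c) - c ∈ maximalIdeal S :=
      Ideal.sub_mem _ ((mem_maximalIdeal _).mpr hn) hc
    rw [add_sub_cancel_right] at h1
    exact (mem_maximalIdeal _).mp h1 isUnit_one
  obtain ⟨u, hu⟩ := this
  exact (Associated.symm ⟨u, by rw [hu]; ring⟩)

/-- Modulo a uniformizer every element is a `p ^ n`-th power, as the residue field is perfect. -/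
theorem exists_eq_pow_add_mul [PerfectField (ResidueField S)] {p : ℕ} [Fact p.Prime] [CharP S p]
    {ϖ : S} (hϖ : Irreducible ϖ) (x : S) (n : ℕ) : ∃ y z : S, x = y ^ p ^ n + ϖ * z := by
  have : CharP (ResidueField S) p := by
    rw [CharP.charP_iff_prime_eq_zero Fact.out, ← map_natCast (residue S), CharP.cast_eq_zero,
      map_zero]
  have : PerfectRing (ResidueField S) p := PerfectField.toPerfectRing p
  obtain ⟨y, hy⟩ := residue_surjective ((iterateFrobeniusEquiv (ResidueField S) p n).symm
    (residue S x))
  have hy' : residue S (x - y ^ p ^ n) = 0 := by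
    rw [map_sub, map_pow, hy, sub_eq_zero]
    exact ((iterateFrobeniusEquiv (ResidueField S) p n).apply_symm_apply _).symm
  rw [residue_eq_zero_iff, hϖ.maximalIdeal_eq, Ideal.mem_span_singleton] at hy'
  obtain ⟨z, hz⟩ := hy'
  exact ⟨y, z, by rw [← hz]; ring⟩

/-- An automorphism that is congruent to the identity moves no element more than it moves a
uniformizer. In characteristic `p` with perfect residue field this needs no generator of the ring:
modulo the uniformizer every element is a `p ^ n`-th power, and Frobenius powers are contracted. -/
theorem addVal_apply_sub_le {p : ℕ} [Fact p.Prime] [CharP S p] (f : S →+* S) (D : Set S) {w : S}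
    (hwm : w ∈ maximalIdeal S) (hf : ∀ x ∈ D, f x - x ∈ maximalIdeal S)
    (hD : ∀ x ∈ D, ∀ n : ℕ, ∃ y ∈ D, ∃ z ∈ D, x = y ^ p ^ n + w * z) {x : S} (hx : x ∈ D) :
    addVal S (f w - w) ≤ addVal S (f x - x) := by
  have hp : p.Prime := Fact.out
  rw [← ENat.forall_natCast_le_iff_le]
  intro k
  induction k generalizing x with
  | zero => intro _; simp
  | succ k ih =>
    intro hk
    have hk' : (k : ℕ∞) ≤ addVal S (f w - w) := le_trans (by exact_mod_cast k.le_succ) hk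
    obtain ⟨y, hy, z, hz, rfl⟩ := hD x hx (k + 1)
    have e : f (y ^ p ^ (k + 1) + w * z) - (y ^ p ^ (k + 1) + w * z) =
        (f y - y) ^ p ^ (k + 1) + ((f w - w) * f z + w * (f z - z)) := by
      rw [sub_pow_char_pow, map_add, map_mul, map_pow]
      ring
    rw [e, ← mem_maximalIdeal_pow_iff]
    refine Ideal.add_mem _ ?_ (Ideal.add_mem _ ?_ ?_)
    · exact Ideal.pow_le_pow_right (Nat.lt_pow_self hp.one_lt).le
        (Ideal.pow_mem_pow (hf y hy) _)
    · exact Ideal.mul_mem_right _ _ ((mem_maximalIdeal_pow_iff _ _).mpr hk)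
    · rw [pow_succ']
      exact Ideal.mul_mem_mul hwm ((mem_maximalIdeal_pow_iff _ _).mpr (ih hz hk'))

variable {G : Type*} [Group G] [MulSemiringAction G S]

variable (S) in
/-- The depth `λ(s) = v(s ϖ - ϖ) - 1 = v(s ϖ / ϖ - 1)` of an element `s` of the inertia group,
where `ϖ` is a uniformizer and `v` the normalized valuation; it is `∞` for `s = 1`. For `s` in the
inertia group, `s` lies in the lower ramification group `G_i` if and only if `i ≤ λ(s)`. -/
def depth (s : G) : ℕ∞ :=
  addVal S (s • (exists_irreducible S).choose - (exists_irreducible S).choose) - 1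

section Perfect

variable [PerfectField (ResidueField S)]

theorem addVal_smul_sub_le {p : ℕ} [Fact p.Prime] [CharP S p] {s : G}
    (hs : s ∈ (maximalIdeal S).inertia G) {ϖ : S} (hϖ : Irreducible ϖ) (x : S) :
    addVal S (s • ϖ - ϖ) ≤ addVal S (s • x - x) :=
  addVal_apply_sub_le (p := p) (MulSemiringAction.toRingHom G S s) Set.univ
    (by rw [hϖ.maximalIdeal_eq]; exact Ideal.mem_span_singleton_self ϖ) (fun x _ => hs x)
    (fun x _ n => by
      obtain ⟨y, z, h⟩ := exists_eq_pow_add_mul (p := p) hϖ x n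
      exact ⟨y, trivial, z, trivial, h⟩) (Set.mem_univ x)

theorem addVal_smul_sub {p : ℕ} [Fact p.Prime] [CharP S p] {s : G}
    (hs : s ∈ (maximalIdeal S).inertia G) {ϖ : S} (hϖ : Irreducible ϖ) :
    addVal S (s • ϖ - ϖ) = depth S s + 1 := by
  have h1 := hs (exists_irreducible S).choose
  have h2 : 1 ≤ addVal S (s • (exists_irreducible S).choose - (exists_irreducible S).choose) :=
    (mem_maximalIdeal_iff _).mp h1
  rw [depth, tsub_add_cancel_of_le h2]
  exact le_antisymm (addVal_smul_sub_le (p := p) hs hϖ _)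
    (addVal_smul_sub_le (p := p) hs (exists_irreducible S).choose_spec _)

theorem mem_inertia_pow_iff {p : ℕ} [Fact p.Prime] [CharP S p] (s : G) (i : ℕ) :
    s ∈ (maximalIdeal S ^ (i + 1)).inertia G ↔
      s ∈ (maximalIdeal S).inertia G ∧ (i : ℕ∞) ≤ depth S s := by
  obtain ⟨ϖ, hϖ⟩ := exists_irreducible S
  constructor
  · intro h
    have hs : s ∈ (maximalIdeal S).inertia G := fun x =>
      Ideal.pow_le_self (Nat.succ_ne_zero i) (h x)
    refine ⟨hs, ?_⟩
    have := (mem_maximalIdeal_pow_iff _ _).mp (h ϖ)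
    rw [addVal_smul_sub (p := p) hs hϖ] at this
    push_cast at this
    exact (ENat.add_le_add_iff_right ENat.one_ne_top).mp this
  · rintro ⟨hs, hi⟩ x
    refine (mem_maximalIdeal_pow_iff _ _).mpr (le_trans ?_ (addVal_smul_sub_le (p := p) hs hϖ x))
    rw [addVal_smul_sub (p := p) hs hϖ]
    push_cast
    gcongr

theorem min_depth_le_depth_mul {p : ℕ} [Fact p.Prime] [CharP S p] {s t : G}
    (hs : s ∈ (maximalIdeal S).inertia G)
    (ht : t ∈ (maximalIdeal S).inertia G) : min (depth S s) (depth S t) ≤ depth S (s * t) := by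
  rw [← ENat.forall_natCast_le_iff_le]
  intro i hi
  rw [le_min_iff] at hi
  exact ((mem_inertia_pow_iff (p := p) _ i).mp (mul_mem
    ((mem_inertia_pow_iff (p := p) s i).mpr ⟨hs, hi.1⟩)
    ((mem_inertia_pow_iff (p := p) t i).mpr ⟨ht, hi.2⟩))).2

theorem depth_inv {p : ℕ} [Fact p.Prime] [CharP S p] {s : G}
    (hs : s ∈ (maximalIdeal S).inertia G) : depth S s⁻¹ = depth S s := by
  refine ENat.eq_of_forall_natCast_le_iff fun i => ?_
  have h := mem_inertia_pow_iff (S := S) (p := p) s i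
  have h' := mem_inertia_pow_iff (S := S) (p := p) s⁻¹ i
  rw [inv_mem_iff] at h'
  have hs' : s⁻¹ ∈ (maximalIdeal S).inertia G := inv_mem hs
  tauto

/-- The key identity behind Herbrand's theorem: the sum over the coset `s H` of the valuations of
`s t ω - ω` is the valuation of `s π - π`, where `π` is a uniformizer of the subring of
`H`-invariants. The polynomial `f = ∏ (X - t ω)` is Eisenstein over the `H`-invariants and its
constant term, another uniformizer there, is moved most by `s`; so `(s f - f)(ω)` has the same
valuation as its constant term. -/
theorem sum_depth_add_one_eq {p : ℕ} [Fact p.Prime] [CharP S p] {H : Subgroup G} [Fintype H]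
    (hH : H ≤ (maximalIdeal S).inertia G) {s : G} (hs : s ∈ (maximalIdeal S).inertia G) {π : S}
    (hπ : ∀ t ∈ H, t • π = π)
    (hcard : addVal S π = Fintype.card H)
    (hD : ∀ x : S, (∀ t ∈ H, t • x = x) → ∀ n : ℕ, ∃ y, (∀ t ∈ H, t • y = y) ∧
      ∃ z, (∀ t ∈ H, t • z = z) ∧ x = y ^ p ^ n + π * z) :
    ∑ t : H, (depth S (s * t) + 1) = addVal S (s • π - π) := by
  obtain ⟨ω, hω⟩ := exists_irreducible S
  set D : Set S := {x | ∀ t ∈ H, t • x = x} with hDdef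
  -- The characteristic polynomial `∏ (X - t ω)` of the uniformizer `ω`.
  set f := MulSemiringAction.charpoly H ω with hf
  have hfD : ∀ i, f.coeff i ∈ D := fun i t ht =>
    MulSemiringAction.smul_coeff_charpoly (G := H) ω i ⟨t, ht⟩
  have hc0 : Associated π (f.coeff 0) := by
    rw [← addVal_eq_iff_associated, hcard, Polynomial.coeff_zero_eq_eval_zero, hf,
      MulSemiringAction.charpoly_eq, Polynomial.eval_prod]
    simp only [Polynomial.eval_sub, Polynomial.eval_X, Polynomial.eval_C, zero_sub]
    have : ∀ t : H, addVal S (-(t • ω)) = 1 := fun t => by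
      rw [AddValuation.map_neg]
      refine addVal_uniformizer ?_
      exact (MulEquiv.irreducible_iff (MulSemiringAction.toRingEquiv H S t)).mpr hω
    have h2 : ∀ A : Finset H, addVal S (∏ t ∈ A, -(t • ω)) = A.card := by
      intro A
      induction A using Finset.cons_induction with
      | empty => simp
      | cons a A ha ih =>
        rw [Finset.prod_cons, addVal_mul, ih, this, Finset.card_cons]
        push_cast
        rw [add_comm]
    rw [h2, Finset.card_univ]
  have hπm : π ∈ maximalIdeal S := by
    rw [mem_maximalIdeal_iff, hcard]
    exact_mod_cast Fintype.card_pos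
  have hπ0 : π ≠ 0 := by
    rintro rfl
    rw [addVal_zero] at hcard
    exact absurd hcard (by simp)
  obtain ⟨u, hu⟩ := hc0
  have huD : (↑u⁻¹ : S) ∈ D := by
    intro t ht
    have h1 : t • (u : S) = u := by
      have := hfD 0 t ht
      rw [← hu, smul_mul', hπ t ht] at this
      exact mul_left_cancel₀ hπ0 this
    have h2 : t • (↑u⁻¹ : S) * (u : S) = 1 := by
      nth_rw 1 [← h1]
      rw [← smul_mul', Units.inv_mul, smul_one]
    exact (Units.eq_inv_of_mul_eq_one_left ((mul_comm _ _).trans h2))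
  have hD0 : ∀ x ∈ D, ∀ n : ℕ, ∃ y ∈ D, ∃ z ∈ D, x = y ^ p ^ n + f.coeff 0 * z := by
    intro x hx n
    obtain ⟨y, hy, z, hz, e⟩ := hD x hx n
    refine ⟨y, hy, ↑u⁻¹ * z, fun t ht => ?_, ?_⟩
    · rw [smul_mul', huD t ht, hz t ht]
    · rw [← hu, e]
      rw [mul_assoc, Units.mul_inv_cancel_left]
  set φ := MulSemiringAction.toRingHom G S s with hφ
  have hφs : ∀ x, φ x = s • x := fun x => rfl
  have hfm : f.coeff 0 ∈ maximalIdeal S := hu ▸ Ideal.mul_mem_right _ _ hπm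
  have key : ∀ x ∈ D, addVal S (s • f.coeff 0 - f.coeff 0) ≤ addVal S (s • x - x) := fun x hx =>
    addVal_apply_sub_le (p := p) φ D hfm (fun x _ => hs x) hD0 hx
  have key2 : addVal S (s • f.coeff 0 - f.coeff 0) = addVal S (s • π - π) :=
    le_antisymm (key π hπ)
      (addVal_apply_sub_le (p := p) φ D hπm (fun x _ => hs x) hD (hfD 0))
  rw [← key2]
  have hdvd : ∀ i, ∃ d, s • f.coeff i - f.coeff i = (s • f.coeff 0 - f.coeff 0) * d := fun i =>
    addVal_le_iff_dvd.mp (key _ (hfD i))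
  choose d hd using hdvd
  -- Evaluate `s f` at `ω`, once from its roots and once from its coefficients.
  have hev : (f.map φ).eval ω = ∏ t : H, (ω - (s * t) • ω) := by
    rw [hf, MulSemiringAction.charpoly_eq, Polynomial.map_prod, Polynomial.eval_prod]
    refine Finset.prod_congr rfl fun t _ => ?_
    simp only [Polynomial.map_sub, Polynomial.map_X, Polynomial.map_C, Polynomial.eval_sub,
      Polynomial.eval_X, Polynomial.eval_C, hφs, mul_smul]
    rfl
  have hev2 : (f.map φ).eval ω = (s • f.coeff 0 - f.coeff 0) + (s • f.coeff 0 - f.coeff 0) *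
      (ω * ∑ i ∈ Finset.range f.natDegree, d (i + 1) * ω ^ i) := by
    have h0 : f.eval ω = 0 := MulSemiringAction.eval_charpoly H ω
    have h1 : (f.map φ).eval ω = (f.map φ).eval ω - f.eval ω := by rw [h0, sub_zero]
    rw [h1, Polynomial.eval_eq_sum_range' (n := f.natDegree + 1)
      (Nat.lt_succ_of_le (Polynomial.natDegree_map_le)),
      Polynomial.eval_eq_sum_range' (n := f.natDegree + 1) (Nat.lt_succ_self _),
      ← Finset.sum_sub_distrib, Finset.sum_range_succ']
    rw [Finset.mul_sum, Finset.mul_sum, add_comm, Polynomial.coeff_map, hφs, ← sub_mul, pow_zero,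
      mul_one]
    congr 1
    refine Finset.sum_congr rfl fun i _ => ?_
    rw [Polynomial.coeff_map, hφs, ← sub_mul, hd]
    ring
  have hfin : addVal S (∏ t : H, (ω - (s * t) • ω)) = addVal S (s • f.coeff 0 - f.coeff 0) := by
    rw [← hev, hev2]
    refine addVal_add_of_dvd ?_ rfl
    refine Ideal.mul_mem_right _ _ ?_
    rw [hω.maximalIdeal_eq]; exact Ideal.mem_span_singleton_self ω
  rw [← hfin]
  have h3 : ∀ t : H, addVal S (ω - (s * t) • ω) = depth S (s * t) + 1 := fun t => by
    rw [← AddValuation.map_neg, neg_sub]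
    exact addVal_smul_sub (p := p) (mul_mem hs (hH t.2)) hω
  have h2 : ∀ A : Finset H, addVal S (∏ t ∈ A, (ω - (s * t) • ω)) =
      ∑ t ∈ A, (depth S (s * t) + 1) := by
    intro A
    induction A using Finset.cons_induction with
    | empty => simp
    | cons a A ha ih => rw [Finset.prod_cons, addVal_mul, ih, h3, Finset.sum_cons]
  rw [h2]

end Perfect

end Depth

/-! ### The Herbrand function of a finite group with a depth function -/

section Combinatorics

open scoped ENNReal

/-- The function `u ↦ ∑ min(λ(s), u)`; divided by the order of the inertia group it is the Herbrand
function of an extension with depth function `λ`. -/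
def herbrandSum {G : Type*} [Fintype G] (l : G → ℝ≥0∞) (u : ℝ≥0∞) : ℝ≥0∞ :=
  ∑ s, min (l s) u

theorem herbrandSum_mono {G : Type*} [Fintype G] (l : G → ℝ≥0∞) : Monotone (herbrandSum l) :=
  fun _ _ h => Finset.sum_le_sum fun _ _ => min_le_min_left _ h

/-- Herbrand's theorem on quotients, in combinatorial form: if the depth `λ'` on the quotient `G'`
of `G` is the average of `λ` over cosets of the kernel, then the upper numbering filtration of `G'`
is the image of that of `G`. An element of maximal depth in its coset satisfies
`λ(s t) = min(λ(s), λ(t))` for `t` in the kernel, which gives the transitivity of the Herbrand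
functions by summing over cosets. -/
theorem le_herbrandSum_iff_exists {G G' : Type*} [Group G] [Group G'] [Fintype G] [Fintype G']
    (f : G →* G') (hf : Function.Surjective f) [Fintype f.ker] (l : G → ℝ≥0∞) (l' : G' → ℝ≥0∞)
    (hmul : ∀ s t, min (l s) (l t) ≤ l (s * t)) (hinv : ∀ s, l s⁻¹ = l s)
    (hsum : ∀ s, (Fintype.card f.ker : ℝ≥0∞) * l' (f s) = ∑ t : f.ker, l (s * t))
    (v : ℝ≥0∞) (τ : G') :
    v * Fintype.card G' ≤ herbrandSum l' (l' τ) ↔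
      ∃ s, f s = τ ∧ v * Fintype.card G ≤ herbrandSum l (l s) := by
  classical
  have hex : ∀ σ : G', ∃ s, f s = σ ∧ ∀ s', f s' = σ → l s' ≤ l s := by
    intro σ
    obtain ⟨s₀, hs₀⟩ := hf σ
    obtain ⟨s, hs, hmax⟩ := Finset.exists_max_image (Finset.univ.filter fun s => f s = σ) l
      ⟨s₀, by simpa using hs₀⟩
    exact ⟨s, by simpa using hs, fun s' hs' => hmax s' (by simpa using hs')⟩
  -- `m σ` has maximal depth among the lifts of `σ`.
  choose m hm hmax using hex
  have hlm : ∀ σ (t : f.ker), l (m σ * t) = min (l t) (l (m σ)) := by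
    intro σ t
    have ht : f (m σ * t) = σ := by rw [map_mul, hm, (f.mem_ker).mp t.2, mul_one]
    refine le_antisymm (le_min ?_ (hmax σ _ ht)) (by rw [min_comm]; exact hmul _ _)
    have := hmul (m σ)⁻¹ (m σ * t)
    rwa [hinv, inv_mul_cancel_left, min_eq_right (hmax σ _ ht)] at this
  set P : ℝ≥0∞ → ℝ≥0∞ := herbrandSum (fun t : f.ker => l t) with hP
  have hPm : Monotone P := herbrandSum_mono _
  have hPl : ∀ σ, P (l (m σ)) = Fintype.card f.ker * l' σ := fun σ => by
    have h := hsum (m σ)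
    rw [hm] at h
    rw [h, hP, herbrandSum]
    exact Finset.sum_congr rfl fun t _ => (hlm σ t).symm
  have hbij : Function.Bijective fun x : G' × f.ker => m x.1 * (x.2 : G) := by
    constructor
    · rintro ⟨σ, t⟩ ⟨σ', t'⟩ h
      have h1 := congrArg f h
      simp only [map_mul, hm, (f.mem_ker).mp t.2, (f.mem_ker).mp t'.2, mul_one] at h1
      subst h1
      simpa using h
    · intro s
      refine ⟨(f s, ⟨(m (f s))⁻¹ * s, ?_⟩), by simp⟩
      rw [f.mem_ker, map_mul, map_inv, hm, inv_mul_cancel]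
  have hG : ∀ u, herbrandSum l u = ∑ σ, min (Fintype.card f.ker * l' σ) (P u) := by
    intro u
    rw [herbrandSum, ← (Equiv.ofBijective _ hbij).sum_comp, Fintype.sum_prod_type]
    refine Finset.sum_congr rfl fun σ _ => ?_
    rw [← hPl, ← hPm.map_min, hP, herbrandSum]
    refine Finset.sum_congr rfl fun t _ => ?_
    rw [Equiv.ofBijective_apply, hlm, min_assoc]
  have hk : (Fintype.card f.ker : ℝ≥0∞) ≠ 0 := by exact_mod_cast Fintype.card_ne_zero
  have hk' : (Fintype.card f.ker : ℝ≥0∞) ≠ ⊤ := by simp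
  have hkey : herbrandSum l (l (m τ)) = Fintype.card f.ker * herbrandSum l' (l' τ) := by
    rw [hG, hPl, herbrandSum, Finset.mul_sum]
    refine Finset.sum_congr rfl fun σ _ => ?_
    exact ((monotone_id.const_mul' _).map_min (f := fun x : ℝ≥0∞ => _ * x)).symm
  have hcard : Fintype.card G = Fintype.card G' * Fintype.card f.ker := by
    rw [← Fintype.card_prod, Fintype.card_of_bijective hbij]
  have hmain : v * Fintype.card G' ≤ herbrandSum l' (l' τ) ↔
      v * Fintype.card G ≤ herbrandSum l (l (m τ)) := by
    rw [hkey, hcard, Nat.cast_mul, ← mul_assoc, mul_comm _ (Fintype.card f.ker : ℝ≥0∞),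
      ENNReal.mul_le_mul_iff_right hk hk']
  rw [hmain]
  exact ⟨fun h => ⟨m τ, hm τ, h⟩, fun ⟨s, hs, h⟩ =>
    h.trans (herbrandSum_mono l (hmax τ s hs))⟩

end Combinatorics

/-! ### The Herbrand function as a sum -/

section Analysis

open scoped ENNReal

theorem antitone_indicator_ofReal_le (a : ℝ≥0∞) :
    Antitone fun x : ℝ => if ENNReal.ofReal x ≤ a then (1 : ℝ) else 0 := by
  intro x y h
  dsimp only
  split_ifs with h1 h2 <;> try norm_num
  exact h2 ((ENNReal.ofReal_le_ofReal h).trans h1)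

theorem integral_indicator_ofReal_le (a : ℝ≥0∞) {u : ℝ} (hu : 0 ≤ u) :
    ∫ x in (0 : ℝ)..u, (if ENNReal.ofReal x ≤ a then (1 : ℝ) else 0) =
      (min a (ENNReal.ofReal u)).toReal := by
  induction a with
  | top => simp [hu]
  | coe c =>
    have h1 : ∀ x : ℝ, ENNReal.ofReal x ≤ (c : ℝ≥0∞) ↔ x ∈ Set.Iic (c : ℝ) := fun x => by
      rw [Set.mem_Iic, ENNReal.ofReal_le_iff_le_toReal (by simp), ENNReal.coe_toReal]
    have h2 : (fun x : ℝ => if ENNReal.ofReal x ≤ (c : ℝ≥0∞) then (1 : ℝ) else 0) =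
        (Set.Iic (c : ℝ)).indicator 1 := by
      funext x
      simp only [h1, Set.indicator_apply, Pi.one_apply]
    rw [h2, intervalIntegral.integral_of_le hu,
      MeasureTheory.integral_indicator_one measurableSet_Iic, MeasureTheory.measureReal_def,
      MeasureTheory.Measure.restrict_apply measurableSet_Iic]
    have h3 : Set.Iic (c : ℝ) ∩ Set.Ioc 0 u = Set.Ioc 0 (min (c : ℝ) u) := by
      ext x
      simp only [Set.mem_inter_iff, Set.mem_Iic, Set.mem_Ioc, le_min_iff]
      tauto
    rw [h3, Real.volume_Ioc, sub_zero, ENNReal.ofReal_min, ENNReal.ofReal_coe_nnreal]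

theorem continuous_herbrandSum {G : Type*} [Fintype G] (l : G → ℝ≥0∞) :
    Continuous (herbrandSum l) :=
  continuous_finsetSum _ fun _ _ => continuous_const.min continuous_id

theorem herbrandSum_ne_top {G : Type*} [Fintype G] (l : G → ℝ≥0∞) {u : ℝ≥0∞} (hu : u ≠ ⊤) :
    herbrandSum l u ≠ ⊤ :=
  ENNReal.sum_ne_top.mpr fun _ _ => ((min_le_right _ _).trans_lt hu.lt_top).ne

theorem le_herbrandSum {G : Type*} [Fintype G] (l : G → ℝ≥0∞) {s : G} (hs : l s = ⊤)
    (u : ℝ≥0∞) : u ≤ herbrandSum l u := by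
  have : min (l s) u ≤ herbrandSum l u :=
    Finset.single_le_sum (f := fun s => min (l s) u) (fun _ _ => zero_le) (Finset.mem_univ s)
  rwa [hs, min_eq_right le_top] at this

/-- Comparison of a depth with the inverse Herbrand function, without inverting it. -/
theorem ofReal_sInf_le_iff {G : Type*} [Fintype G] (l : G → ℝ≥0∞) {s₀ : G} (hs₀ : l s₀ = ⊤)
    (φ : ℝ → ℝ) (hφ : ∀ u, 0 ≤ u → φ u = (herbrandSum l (ENNReal.ofReal u)).toReal /
      Fintype.card G) {v : ℝ} (hv : 0 ≤ v) (a : ℝ≥0∞) :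
    ENNReal.ofReal (sInf {u : ℝ | 0 ≤ u ∧ v ≤ φ u}) ≤ a ↔
      ENNReal.ofReal v * Fintype.card G ≤ herbrandSum l a := by
  have hG : (0 : ℝ) < Fintype.card G := by exact_mod_cast Fintype.card_pos_iff.mpr ⟨s₀⟩
  set A := {u : ℝ | 0 ≤ u ∧ v ≤ φ u} with hA
  have hmem : ∀ u, u ∈ A ↔ 0 ≤ u ∧
      ENNReal.ofReal v * Fintype.card G ≤ herbrandSum l (ENNReal.ofReal u) := by
    intro u
    rw [hA, Set.mem_ofPred_eq, and_congr_right_iff]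
    intro hu
    rw [hφ u hu, le_div_iff₀ hG, ← ENNReal.ofReal_le_iff_le_toReal
      (herbrandSum_ne_top l ENNReal.ofReal_ne_top), ENNReal.ofReal_mul hv, ENNReal.ofReal_natCast]
  have hclosed : IsClosed A := by
    have : A = Set.Ici 0 ∩ {u : ℝ | ENNReal.ofReal v * Fintype.card G ≤
        herbrandSum l (ENNReal.ofReal u)} := by
      ext u; exact hmem u
    rw [this]
    exact isClosed_Ici.inter (isClosed_le continuous_const
      ((continuous_herbrandSum l).comp ENNReal.continuous_ofReal))
  have hne : A.Nonempty := by
    refine ⟨v * Fintype.card G, (hmem _).mpr ⟨by positivity, ?_⟩⟩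
    refine le_trans (le_of_eq ?_) (le_herbrandSum l hs₀ _)
    rw [ENNReal.ofReal_mul hv, ENNReal.ofReal_natCast]
  have hbdd : BddBelow A := ⟨0, fun u hu => hu.1⟩
  have hψ := (hmem _).mp (hclosed.csInf_mem hne hbdd)
  constructor
  · intro h
    exact hψ.2.trans (herbrandSum_mono l h)
  · intro h
    rcases eq_or_ne a ⊤ with rfl | ha
    · exact le_top
    · rw [ENNReal.ofReal_le_iff_le_toReal ha]
      refine csInf_le hbdd ((hmem _).mpr ⟨ENNReal.toReal_nonneg, ?_⟩)
      rwa [ENNReal.ofReal_toReal ha]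

end Analysis

/-! ### Ramification groups at finite level -/

section FiniteLevel

open scoped ENNReal
open IsLocalRing
open IsDiscreteValuationRing hiding maximalIdeal

theorem natCeil_le_iff_ofReal_le (x : ℝ) (a : ℕ∞) :
    ((⌈x⌉₊ : ℕ) : ℕ∞) ≤ a ↔ ENNReal.ofReal x ≤ (a : ℝ≥0∞) := by
  induction a with
  | top => simp
  | coe n =>
    rw [ENat.toENNReal_coe, Nat.cast_le, Nat.ceil_le, ENNReal.ofReal_le_natCast]

variable (R K F : Type*) [CommRing R] [Field K] [Field F] [Algebra K F] [Algebra R K] [Algebra R F]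
  [IsScalarTower R K F]

instance smulCommClass_algEquiv : SMulCommClass (F ≃ₐ[K] F) R F :=
  ⟨fun σ a x => (σ.restrictScalars R).toLinearMap.map_smul a x⟩

/-- The inertia group of `F / K`. -/
abbrev inertiaGroup [IsLocalRing (integralClosure R F)] : Subgroup (F ≃ₐ[K] F) :=
  (maximalIdeal (integralClosure R F)).inertia (F ≃ₐ[K] F)

theorem maxIdeal_eq [IsLocalRing (integralClosure R F)] :
    maxIdeal R F = maximalIdeal (integralClosure R F) := by
  have h := IsLocalRing.ringJacobson_eq_maximalIdeal (integralClosure R F)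
  exact h

theorem mem_lowerGroup_zero [IsLocalRing (integralClosure R F)] (s : F ≃ₐ[K] F) :
    s ∈ lowerGroup R K F 0 ↔ s ∈ inertiaGroup R K F := by
  rw [lowerGroup, maxIdeal_eq, zero_add, pow_one]

variable [IsDiscreteValuationRing (integralClosure R F)]

theorem depth_one : depth (integralClosure R F) (1 : F ≃ₐ[K] F) = ⊤ := by
  rw [depth, one_smul, sub_self, addVal_zero]
  rfl

variable [PerfectField (ResidueField (integralClosure R F))]

theorem mem_lowerGroup_iff {p : ℕ} [Fact p.Prime] [CharP F p] (s : F ≃ₐ[K] F) (i : ℕ) :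
    s ∈ lowerGroup R K F i ↔
      s ∈ inertiaGroup R K F ∧ (i : ℕ∞) ≤ depth (integralClosure R F) s := by
  have : CharP (integralClosure R F) p :=
    (RingHom.charP_iff (algebraMap (integralClosure R F) F) Subtype.val_injective p).mpr ‹_›
  rw [lowerGroup, maxIdeal_eq]
  exact mem_inertia_pow_iff (p := p) s i

theorem mem_lowerGroupReal_iff {p : ℕ} [Fact p.Prime] [CharP F p] (s : F ≃ₐ[K] F) (x : ℝ) :
    s ∈ lowerGroupReal R K F x ↔ s ∈ inertiaGroup R K F ∧
      ENNReal.ofReal x ≤ (depth (integralClosure R F) s : ℝ≥0∞) := by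
  rw [lowerGroupReal, mem_lowerGroup_iff R K F (p := p), natCeil_le_iff_ofReal_le]

theorem finiteUpperGroup_le_inertiaGroup {p : ℕ} [Fact p.Prime] [CharP F p] (v : ℝ) :
    finiteUpperGroup R K F v ≤ inertiaGroup R K F := fun s hs =>
  ((mem_lowerGroupReal_iff (p := p) R K F s _).mp hs).1

variable [Fintype (inertiaGroup R K F)]

theorem herbrandPhi_eq {p : ℕ} [Fact p.Prime] [CharP F p] {u : ℝ} (hu : 0 ≤ u) :
    herbrandPhi R K F u = (herbrandSum (fun s : inertiaGroup R K F =>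
      (depth (integralClosure R F) (s : F ≃ₐ[K] F) : ℝ≥0∞)) (ENNReal.ofReal u)).toReal /
        Fintype.card (inertiaGroup R K F) := by
  have h0 : Nat.card (lowerGroup R K F 0) = Fintype.card (inertiaGroup R K F) := by
    rw [← Nat.card_eq_fintype_card]
    refine Nat.card_congr (Equiv.subtypeEquivRight fun s => mem_lowerGroup_zero R K F s)
  have h1 : ∀ x : ℝ, (Nat.card (lowerGroupReal R K F x) : ℝ) = ∑ s : inertiaGroup R K F,
      if ENNReal.ofReal x ≤ (depth (integralClosure R F) (s : F ≃ₐ[K] F) : ℝ≥0∞)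
        then (1 : ℝ) else 0 := by
    intro x
    rw [Finset.sum_boole, ← Fintype.card_subtype, ← Nat.card_eq_fintype_card]
    congr 1
    refine Nat.card_congr ((Equiv.subtypeEquivRight fun s =>
      mem_lowerGroupReal_iff (p := p) R K F s x).trans ?_)
    exact (Equiv.subtypeSubtypeEquivSubtypeInter _ _).symm
  rw [herbrandPhi, h0]
  simp_rw [h1]
  rw [intervalIntegral.integral_div, intervalIntegral.integral_finsetSum
    fun s _ => (antitone_indicator_ofReal_le _).intervalIntegrable, herbrandSum,
    ENNReal.toReal_sum fun s _ => ((min_le_right _ _).trans_lt ENNReal.ofReal_lt_top).ne]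
  simp_rw [integral_indicator_ofReal_le _ hu]

/-- Membership in an upper ramification group in terms of depths: `s` lies in `G^v` if and only if
`v ≤ φ(λ(s))`, where `φ` is the Herbrand function. -/
theorem mem_finiteUpperGroup_iff {p : ℕ} [Fact p.Prime] [CharP F p] (s : inertiaGroup R K F)
    {v : ℝ} (hv : 0 ≤ v) :
    (s : F ≃ₐ[K] F) ∈ finiteUpperGroup R K F v ↔
      ENNReal.ofReal v * Fintype.card (inertiaGroup R K F) ≤
        herbrandSum (fun s : inertiaGroup R K F =>
          (depth (integralClosure R F) (s : F ≃ₐ[K] F) : ℝ≥0∞))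
          (depth (integralClosure R F) (s : F ≃ₐ[K] F)) := by
  rw [finiteUpperGroup, mem_lowerGroupReal_iff R K F (p := p), and_iff_right s.2, herbrandPsi]
  exact ofReal_sInf_le_iff _ (s₀ := 1) (by simp [depth_one]) _
    (fun u hu => herbrandPhi_eq (p := p) R K F hu) hv _

theorem finiteUpperGroup_antitone {p : ℕ} [Fact p.Prime] [CharP F p] {v w : ℝ} (hv : 0 ≤ v)
    (h : v ≤ w) :
    finiteUpperGroup R K F w ≤ finiteUpperGroup R K F v := by
  intro s hs
  have hsI := finiteUpperGroup_le_inertiaGroup (p := p) R K F w hs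
  rw [← Subgroup.coe_mk (inertiaGroup R K F) s hsI,
    mem_finiteUpperGroup_iff (p := p) R K F _ (hv.trans h)] at hs
  rw [← Subgroup.coe_mk (inertiaGroup R K F) s hsI, mem_finiteUpperGroup_iff (p := p) R K F _ hv]
  refine le_trans ?_ hs
  gcongr

end FiniteLevel

/-! ### Ramification indices of extensions of discrete valuation rings -/

section RamificationIndex

open IsLocalRing
open IsDiscreteValuationRing hiding maximalIdeal

/-- An embedding of discrete valuation rings multiplies valuations by a constant. -/
theorem addVal_map_eq_mul {A B : Type*} [CommRing A] [IsDomain A] [IsDiscreteValuationRing A]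
    [CommRing B] [IsDomain B] [IsDiscreteValuationRing B] (j : A →+* B) {π : A}
    (hπ : Irreducible π) (hj : addVal B (j π) ≠ 0) (x : A) :
    addVal B (j x) = addVal B (j π) * addVal A x := by
  rcases eq_or_ne x 0 with rfl | hx
  · rw [map_zero, addVal_zero, addVal_zero, ENat.mul_top hj]
  · obtain ⟨n, u, rfl⟩ := eq_unit_mul_pow_irreducible hx hπ
    have hu : addVal B (j u) = 0 := addVal_eq_zero_iff.mpr (u.isUnit.map j)
    rw [map_mul, map_pow, addVal_mul, addVal_pow, addVal_mul, addVal_pow, addVal_uniformizer hπ,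
      addVal_eq_zero_of_unit, hu, zero_add, zero_add, nsmul_eq_mul, nsmul_eq_mul, mul_one, mul_comm]

variable {A B : Type*} [CommRing A] [IsDomain A] [IsDiscreteValuationRing A]
    [CommRing B] [IsDomain B] [IsDiscreteValuationRing B] [Algebra A B] [Module.Finite A B]
    [FaithfulSMul A B]

theorem addVal_algebraMap_eq_ramificationIdx {π : A} (hπ : Irreducible π) :
    addVal B (algebraMap A B π) = ((maximalIdeal B).ramificationIdx A : ℕ) := by
  have h0 : algebraMap A B π ≠ 0 := by
    rw [Ne, FaithfulSMul.algebraMap_eq_zero_iff]; exact hπ.ne_zero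
  have hmap : (maximalIdeal A).map (algebraMap A B) = Ideal.span {algebraMap A B π} := by
    rw [hπ.maximalIdeal_eq, Ideal.map_span, Set.image_singleton]
  obtain ⟨ϖ, hϖ⟩ := exists_irreducible B
  obtain ⟨n, u, hn⟩ := eq_unit_mul_pow_irreducible h0 hϖ
  rw [Ideal.IsDedekindDomain.ramificationIdx_eq_multiplicity (maximalIdeal A) _ (by
    rw [hmap, Ne, Ideal.span_singleton_eq_bot]; exact h0), hmap, hn,
    Ideal.span_singleton_mul_left_unit u.isUnit, ← Ideal.span_singleton_pow, ← hϖ.maximalIdeal_eq,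
    addVal_def' u hϖ n, multiplicity_pow_self (IsDiscreteValuationRing.not_a_field B)
      (Ideal.isUnit_iff.not.mpr (maximalIdeal.isMaximal B).ne_top)]

/-- The ramification index is at most the degree. -/
theorem addVal_algebraMap_le_finrank {π : A} (hπ : Irreducible π) :
    addVal B (algebraMap A B π) ≤ Module.finrank A B := by
  have : Module.Flat A B := Module.Flat.of_free
  rw [addVal_algebraMap_eq_ramificationIdx hπ, Nat.cast_le]
  have : Fintype ((maximalIdeal A).primesOver B) :=
    (Algebra.QuasiFinite.finite_primesOver _).fintype
  rw [← Ideal.sum_ramification_inertia_eq_finrank (maximalIdeal A) B]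
  refine le_trans ?_ (Finset.single_le_sum
    (f := fun q : (maximalIdeal A).primesOver B => q.1.ramificationIdx A * q.1.inertiaDeg A)
    (fun _ _ => Nat.zero_le _)
    (Finset.mem_univ (Ideal.primesOver.mk (maximalIdeal A) (maximalIdeal B))))
  refine Nat.le_mul_of_pos_right _ ?_
  exact Ideal.inertiaDeg_pos _ _

/-- The valuation of a uniformizer of the base is the order of the inertia group. -/
theorem addVal_algebraMap_eq_card_inertia {G : Type*} [Group G] [Finite G] [MulSemiringAction G B]
    [IsGaloisGroup G A B] [PerfectField (ResidueField A)] {π : A} (hπ : Irreducible π) :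
    addVal B (algebraMap A B π) = Nat.card ((maximalIdeal B).inertia G) := by
  have : Module.Flat A B := Module.Flat.of_free
  have : PerfectField (maximalIdeal A).ResidueField := by
    have e : ResidueField A ≃+* (maximalIdeal A).ResidueField :=
      RingEquiv.ofBijective (algebraMap (A ⧸ maximalIdeal A) (maximalIdeal A).ResidueField)
        (maximalIdeal A).bijective_algebraMap_quotient_residueField
    exact PerfectField.of_ringEquiv e
  rw [addVal_algebraMap_eq_ramificationIdx hπ,
    Ideal.card_inertia_eq_ramificationIdxIn (G := G) (maximalIdeal A) (maximalIdeal B),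
    Ideal.ramificationIdxIn_eq_ramificationIdx (maximalIdeal A) (maximalIdeal B) G]

end RamificationIndex

/-! ### Integral closures of a discrete valuation ring in finite extensions -/

section IntegralClosure

open IsLocalRing
open IsDiscreteValuationRing hiding maximalIdeal

variable (R K F : Type*) [CommRing R] [IsDomain R] [IsDiscreteValuationRing R] [Field K] [Field F]
  [Algebra K F] [Algebra R K] [IsFractionRing R K] [Algebra R F] [IsScalarTower R K F]

include K in
theorem faithfulSMul_integralClosure : FaithfulSMul R (integralClosure R F) := by
  have : FaithfulSMul R F := by
    rw [faithfulSMul_iff_algebraMap_injective, IsScalarTower.algebraMap_eq R K F]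
    exact (algebraMap K F).injective.comp (IsFractionRing.injective R K)
  infer_instance

variable [FiniteDimensional K F] [Algebra.IsSeparable K F]

include K in
theorem finrank_integralClosure :
    Module.finrank R (integralClosure R F) = Module.finrank K F := by
  have : FaithfulSMul R F := by
    rw [faithfulSMul_iff_algebraMap_injective, IsScalarTower.algebraMap_eq R K F]
    exact (algebraMap K F).injective.comp (IsFractionRing.injective R K)
  exact IsIntegralClosure.rank R K F (integralClosure R F)

include K in
theorem finite_integralClosure : Module.Finite R (integralClosure R F) :=
  IsIntegralClosure.finite R K F (integralClosure R F)

include K in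
theorem isDiscreteValuationRing_integralClosure [IsLocalRing (integralClosure R F)] :
    IsDiscreteValuationRing (integralClosure R F) := by
  have := faithfulSMul_integralClosure R K F
  have : IsDedekindDomain (integralClosure R F) := integralClosure.isDedekindDomain R K F
  have h : ¬ IsField (integralClosure R F) := fun h =>
    IsDiscreteValuationRing.not_isField R (isField_of_isIntegral_of_isField
      (FaithfulSMul.algebraMap_injective R (integralClosure R F)) h)
  exact ((IsDiscreteValuationRing.TFAE _ h).out 0 2).mpr this

include K in
theorem perfectField_residueField_integralClosure [IsLocalRing (integralClosure R F)]
    [PerfectField (ResidueField R)] : PerfectField (ResidueField (integralClosure R F)) := by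
  have := faithfulSMul_integralClosure R K F
  have := finite_integralClosure R K F
  exact Algebra.IsAlgebraic.perfectField (ResidueField R)

include K in
theorem isLocalRing_integralClosure_of_isAdicComplete [IsAdicComplete (maximalIdeal R) R] :
    IsLocalRing (integralClosure R F) := by
  have := finite_integralClosure R K F
  exact isLocalRing_of_finite_of_isAdicComplete R _

end IntegralClosure

/-! ### Towers of integral closures -/

section Tower

open IsLocalRing
open IsDiscreteValuationRing hiding maximalIdeal

instance isScalarTower_intermediateField {R K N : Type*} [CommRing R] [Field K] [Field N]
    [Algebra K N] [Algebra R K] [Algebra R N] [IsScalarTower R K N] (T : IntermediateField K N) :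
    IsScalarTower R T N :=
  IsScalarTower.of_algebraMap_eq fun _ => rfl

section Basic

variable (R K F N : Type*) [CommRing R] [Field K] [Field F] [Field N] [Algebra R F]
  [Algebra R N] [Algebra F N] [IsScalarTower R F N]

/-- The inclusion of rings of integers of a tower of fields. -/
abbrev integersMap : integralClosure R F →ₐ[R] integralClosure R N :=
  (IsScalarTower.toAlgHom R F N).mapIntegralClosure

theorem integersMap_injective : Function.Injective (integersMap R F N) := fun _ _ h =>
  Subtype.ext ((algebraMap F N).injective (congrArg Subtype.val h))

theorem exists_integersMap_eq (x : integralClosure R N) (y : F) (h : algebraMap F N y = x) :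
    ∃ z, integersMap R F N z = x := by
  refine ⟨⟨y, ?_⟩, Subtype.ext h⟩
  have := x.2
  rw [← h] at this
  exact (isIntegral_algHom_iff (IsScalarTower.toAlgHom R F N) (algebraMap F N).injective).mp this

instance isLocalHom_integersMap : IsLocalHom (integersMap R F N) := by
  constructor
  intro x hx
  obtain ⟨y, hy⟩ := hx.exists_right_inv
  have h1 : algebraMap F N x * (y : N) = 1 := congrArg Subtype.val hy
  have hx0 : algebraMap F N x ≠ 0 := left_ne_zero_of_mul_eq_one h1
  obtain ⟨z, hz⟩ := exists_integersMap_eq R F N y (x : F)⁻¹ (by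
    rw [map_inv₀]; exact inv_eq_of_mul_eq_one_right h1)
  refine IsUnit.of_mul_eq_one z (integersMap_injective R F N ?_)
  rw [map_mul, hz, hy, map_one]

theorem isLocalRing_integralClosure_of_tower [IsLocalRing (integralClosure R N)] :
    IsLocalRing (integralClosure R F) :=
  have : IsLocalHom (integersMap R F N).toRingHom :=
    ⟨fun x hx => (isLocalHom_integersMap R F N).1 x hx⟩
  (integersMap R F N).toRingHom.domain_isLocalRing

theorem integersMap_mem_maximalIdeal_iff [IsLocalRing (integralClosure R F)]
    [IsLocalRing (integralClosure R N)] (x : integralClosure R F) :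
    integersMap R F N x ∈ maximalIdeal (integralClosure R N) ↔
      x ∈ maximalIdeal (integralClosure R F) := by
  rw [mem_maximalIdeal, mem_maximalIdeal, mem_nonunits_iff, mem_nonunits_iff, isUnit_map_iff]

end Basic

section Inertia

variable (R K N : Type*) [CommRing R] [IsDomain R] [IsDiscreteValuationRing R]
  [PerfectField (ResidueField R)] [Field K] [Field N]
  [Algebra K N] [Algebra R K] [IsFractionRing R K] [Algebra R N] [IsScalarTower R K N]
  [FiniteDimensional K N] [IsGalois K N]

include K in
/-- The order of the inertia group is the valuation of a uniformizer of the base. -/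
theorem addVal_algebraMap_eq_card_inertiaGroup [IsDiscreteValuationRing (integralClosure R N)]
    {π : R} (hπ : Irreducible π) :
    addVal (integralClosure R N) (algebraMap R (integralClosure R N) π) =
      Nat.card (inertiaGroup R K N) := by
  have := finite_integralClosure R K N
  have := faithfulSMul_integralClosure R K N
  have : IsFractionRing (integralClosure R N) N :=
    integralClosure.isFractionRing_of_finite_extension K N
  have : IsGaloisGroup (N ≃ₐ[K] N) R (integralClosure R N) :=
    IsGaloisGroup.of_isFractionRing (N ≃ₐ[K] N) R (integralClosure R N) K N
  exact addVal_algebraMap_eq_card_inertia hπ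

/-- The order of a subgroup `H` of the inertia group is the valuation of a uniformizer of the fixed
field of `H`: the extension by `H` is totally ramified. -/
theorem addVal_integersMap_fixedPoints {H : Subgroup (N ≃ₐ[K] N)}
    [IsDiscreteValuationRing (integralClosure R N)] (hH : H ≤ inertiaGroup R K N)
    [IsDiscreteValuationRing (integralClosure R (FixedPoints.intermediateField H :
      IntermediateField K N))]
    {π : integralClosure R (FixedPoints.intermediateField H : IntermediateField K N)}
    (hπ : Irreducible π) :
    addVal (integralClosure R N) (integersMap R
      (FixedPoints.intermediateField H : IntermediateField K N) N π) = Nat.card H := by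
  set T := (FixedPoints.intermediateField H : IntermediateField K N)
  have := finite_integralClosure R K N
  have := perfectField_residueField_integralClosure R K T
  let _ : Algebra (integralClosure R T) (integralClosure R N) := (integersMap R T N).toAlgebra
  have : IsScalarTower R (integralClosure R T) (integralClosure R N) :=
    IsScalarTower.of_algebraMap_eq fun x => ((integersMap R T N).commutes x).symm
  have : IsScalarTower (integralClosure R T) (integralClosure R N) N :=
    IsScalarTower.of_algebraMap_eq fun x => rfl
  have : IsScalarTower (integralClosure R T) T N :=
    IsScalarTower.of_algebraMap_eq fun x => rfl
  have : Module.Finite (integralClosure R T) (integralClosure R N) :=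
    Module.Finite.of_restrictScalars_finite R _ _
  have : FaithfulSMul (integralClosure R T) (integralClosure R N) := by
    rw [faithfulSMul_iff_algebraMap_injective]
    exact integersMap_injective R T N
  have : IsFractionRing (integralClosure R N) N :=
    integralClosure.isFractionRing_of_finite_extension K N
  have : IsFractionRing (integralClosure R T) T :=
    integralClosure.isFractionRing_of_finite_extension K T
  have : IsGaloisGroup H (integralClosure R T) (integralClosure R N) :=
    IsGaloisGroup.of_isFractionRing H (integralClosure R T) (integralClosure R N) T N
  have h := addVal_algebraMap_eq_card_inertia (G := H) (B := integralClosure R N) hπ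
  have htop : (maximalIdeal (integralClosure R N)).inertia H = ⊤ := by
    rw [eq_top_iff]
    intro t _
    exact fun x => hH t.2 x
  rw [htop, Subgroup.card_top] at h
  exact h

end Inertia

end Tower

/-! ### Herbrand's theorem for finite extensions -/

section Herbrand

open scoped ENNReal
open IsLocalRing
open IsDiscreteValuationRing hiding maximalIdeal

variable (R K F N : Type*) [CommRing R] [Field K] [Algebra R K] [Field F] [Field N] [Algebra K F]
  [Algebra K N] [Algebra R F] [Algebra R N] [Algebra F N] [IsScalarTower R K F]
  [IsScalarTower R K N] [IsScalarTower K F N] [IsScalarTower R F N] [IsGalois K F]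

theorem integersMap_restrictNormalHom_smul (s : N ≃ₐ[K] N) (x : integralClosure R F) :
    integersMap R F N (AlgEquiv.restrictNormalHom F s • x) = s • integersMap R F N x :=
  Subtype.ext (AlgEquiv.restrictNormal_commutes s F x)

theorem restrictNormalHom_mem_inertiaGroup [IsLocalRing (integralClosure R F)]
    [IsLocalRing (integralClosure R N)] {s : N ≃ₐ[K] N} (hs : s ∈ inertiaGroup R K N) :
    AlgEquiv.restrictNormalHom F s ∈ inertiaGroup R K F := by
  intro x
  change _ ∈ maximalIdeal (integralClosure R F)
  rw [← integersMap_mem_maximalIdeal_iff R F N, map_sub, integersMap_restrictNormalHom_smul]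
  exact hs _

/-- The restriction of inertia groups of a tower of Galois extensions. -/
def inertiaRestrict [IsLocalRing (integralClosure R F)] [IsLocalRing (integralClosure R N)] :
    inertiaGroup R K N →* inertiaGroup R K F :=
  ((AlgEquiv.restrictNormalHom F).comp (inertiaGroup R K N).subtype).codRestrict _ fun s =>
    restrictNormalHom_mem_inertiaGroup R K F N s.2

/-- The kernel of the restriction of inertia groups, as a subgroup of the Galois group. -/
abbrev relInertia [IsLocalRing (integralClosure R F)] [IsLocalRing (integralClosure R N)] :
    Subgroup (N ≃ₐ[K] N) :=
  (inertiaRestrict R K F N).ker.map (inertiaGroup R K N).subtype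

theorem relInertia_le [IsLocalRing (integralClosure R F)] [IsLocalRing (integralClosure R N)] :
    relInertia R K F N ≤ inertiaGroup R K N := by
  rintro _ ⟨t, _, rfl⟩
  exact t.2

theorem relInertia_apply_algebraMap [IsLocalRing (integralClosure R F)]
    [IsLocalRing (integralClosure R N)] {s : N ≃ₐ[K] N} (hs : s ∈ relInertia R K F N) (x : F) :
    s (algebraMap F N x) = algebraMap F N x := by
  obtain ⟨t, ht, rfl⟩ := hs
  have h1 : AlgEquiv.restrictNormalHom F (t : N ≃ₐ[K] N) = 1 := congrArg Subtype.val ht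
  have h2 := AlgEquiv.restrictNormal_commutes (t : N ≃ₐ[K] N) F x
  change algebraMap F N (AlgEquiv.restrictNormalHom F (t : N ≃ₐ[K] N) x) = _ at h2
  rw [h1] at h2
  exact h2.symm

variable [IsDomain R] [IsDiscreteValuationRing R] [PerfectField (ResidueField R)]
  [IsFractionRing R K] [FiniteDimensional K N] [IsGalois K N] [FiniteDimensional K F]
  [IsDiscreteValuationRing (integralClosure R F)] [IsDiscreteValuationRing (integralClosure R N)]

/-- Inertia of `N / K` surjects onto inertia of `F / K`, and the ramification index of `N / F` is
the order of the kernel. Both follow by counting from the fact that ramification indices of Galois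
extensions are orders of inertia groups. The count also shows that the fixed field of the kernel is
unramified over `F`, so a uniformizer of `F` is one of that fixed field; its ring of integers
therefore consists of `p ^ n`-th powers modulo `π`. -/
theorem inertiaRestrict_surjective_and_addVal {π : integralClosure R F} (hπ : Irreducible π) :
    Function.Surjective (inertiaRestrict R K F N) ∧
      addVal (integralClosure R N) (integersMap R F N π) = Nat.card (relInertia R K F N) ∧
      ∀ x : integralClosure R N, (∀ t ∈ relInertia R K F N, t • x = x) →
        ∀ p : ℕ, p.Prime → CharP K p → ∀ n : ℕ,
        ∃ y, (∀ t ∈ relInertia R K F N, t • y = y) ∧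
          ∃ z, (∀ t ∈ relInertia R K F N, t • z = z) ∧
            x = y ^ p ^ n + integersMap R F N π * z := by
  set H := relInertia R K F N with hHdef
  set T := (FixedPoints.intermediateField H : IntermediateField K N) with hT
  have hTmem : ∀ x : N, x ∈ T ↔ ∀ t ∈ H, t x = x := fun x =>
    ⟨fun h t ht => h ⟨t, ht⟩, fun h t => h t.1 t.2⟩
  have : IsLocalRing (integralClosure R T) := isLocalRing_integralClosure_of_tower R T N
  have : IsDiscreteValuationRing (integralClosure R T) :=
    isDiscreteValuationRing_integralClosure R K T
  have : PerfectField (ResidueField (integralClosure R T)) :=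
    perfectField_residueField_integralClosure R K T
  obtain ⟨ϖ, hϖ⟩ := exists_irreducible (integralClosure R T)
  obtain ⟨π₀, hπ₀⟩ := exists_irreducible R
  have hTN : ∀ x, addVal (integralClosure R N) (integersMap R T N x) =
      Nat.card H * addVal (integralClosure R T) x := by
    intro x
    have h1 := addVal_integersMap_fixedPoints R K N (relInertia_le R K F N) hϖ
    have h2 := addVal_map_eq_mul (integersMap R T N).toRingHom hϖ (by
      change addVal _ (integersMap R T N ϖ) ≠ 0
      rw [h1]; exact_mod_cast Nat.card_pos.ne') x
    change addVal _ (integersMap R T N x) = addVal _ (integersMap R T N ϖ) * _ at h2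
    rw [h2, h1]
  have hFT : ∀ x : integralClosure R F, ∃ y : integralClosure R T,
      integersMap R T N y = integersMap R F N x := fun x =>
    exists_integersMap_eq R T N _ ⟨algebraMap F N x, (hTmem _).mpr fun t ht =>
      relInertia_apply_algebraMap R K F N ht x⟩ rfl
  obtain ⟨π', hπ'⟩ := hFT π
  have hπm : integersMap R F N π ∈ maximalIdeal (integralClosure R N) := by
    rw [integersMap_mem_maximalIdeal_iff]
    exact (mem_maximalIdeal _).mpr hπ.not_isUnit
  have hπ'm : π' ∈ maximalIdeal (integralClosure R T) := by
    rw [← integersMap_mem_maximalIdeal_iff R T N, hπ']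
    exact hπm
  have hb : addVal (integralClosure R N) (integersMap R F N π) =
      Nat.card H * addVal (integralClosure R T) π' := by rw [← hπ', hTN]
  have hFN := addVal_map_eq_mul (integersMap R F N).toRingHom hπ (by
      change addVal _ (integersMap R F N π) ≠ 0
      have := (mem_maximalIdeal_iff _).mp hπm
      exact (zero_lt_one.trans_le this).ne')
  change ∀ x, addVal _ (integersMap R F N x) = addVal _ (integersMap R F N π) * _ at hFN
  have h1 : (Nat.card (inertiaGroup R K N) : ℕ∞) =
      Nat.card H * addVal (integralClosure R T) π' * Nat.card (inertiaGroup R K F) := by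
    rw [← addVal_algebraMap_eq_card_inertiaGroup R K N hπ₀,
      ← addVal_algebraMap_eq_card_inertiaGroup R K F hπ₀, ← hb, ← hFN]
    congr 1
    exact ((integersMap R F N).commutes π₀).symm
  have hcH : Nat.card H = Nat.card (inertiaRestrict R K F N).ker :=
    (Nat.card_congr ((inertiaRestrict R K F N).ker.equivMapOfInjective _
      (Subgroup.subtype_injective _)).toEquiv).symm
  have h2 : Nat.card (inertiaGroup R K N) = Nat.card (inertiaRestrict R K F N).range *
      Nat.card H := by
    rw [hcH,
      ← Nat.card_congr (QuotientGroup.quotientKerEquivRange (inertiaRestrict R K F N)).toEquiv]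
    exact Subgroup.card_eq_card_quotient_mul_card_subgroup _
  have h3 : Nat.card (inertiaRestrict R K F N).range ≤ Nat.card (inertiaGroup R K F) :=
    Subgroup.card_le_card_group _
  have hHpos : 0 < Nat.card H := Nat.card_pos
  have hFpos : 0 < Nat.card (inertiaGroup R K F) := Nat.card_pos
  have hπ'v : addVal (integralClosure R T) π' = 1 := by
    have h4 := (mem_maximalIdeal_iff _).mp hπ'm
    rcases eq_or_ne (addVal (integralClosure R T) π') ⊤ with htop | htop
    · rw [htop, ENat.mul_top (by exact_mod_cast hHpos.ne'),
        ENat.top_mul (by exact_mod_cast hFpos.ne')] at h1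
      exact absurd h1 (ENat.natCast_ne_top _)
    · obtain ⟨a, ha⟩ := ENat.ne_top_iff_exists.mp htop
      rw [← ha] at h1 h4 ⊢
      norm_cast at h1 h4 ⊢
      rw [h2] at h1
      have h5 : a * (Nat.card H * Nat.card (inertiaGroup R K F)) ≤
          1 * (Nat.card H * Nat.card (inertiaGroup R K F)) := by
        calc a * (Nat.card H * Nat.card (inertiaGroup R K F))
            = Nat.card H * a * Nat.card (inertiaGroup R K F) := by ring
          _ = Nat.card (inertiaRestrict R K F N).range * Nat.card H := h1.symm
          _ ≤ Nat.card (inertiaGroup R K F) * Nat.card H := Nat.mul_le_mul_right _ h3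
          _ = _ := by ring
      exact le_antisymm (Nat.le_of_mul_le_mul_right h5 (Nat.mul_pos hHpos hFpos)) h4
  refine ⟨?_, ?_, ?_⟩
  · rw [← MonoidHom.range_eq_top]
    refine Subgroup.eq_top_of_card_eq _ ?_
    rw [hπ'v, mul_one] at h1
    norm_cast at h1
    rw [h2, mul_comm] at h1
    exact Nat.eq_of_mul_eq_mul_left hHpos h1
  · rw [hb, hπ'v, mul_one]
  · intro x hx p hp hK n
    have : Fact p.Prime := ⟨hp⟩
    have : CharP T p := (RingHom.charP_iff (algebraMap K T) (algebraMap K T).injective p).mp hK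
    have : CharP (integralClosure R T) p :=
      (RingHom.charP_iff (algebraMap (integralClosure R T) T) Subtype.val_injective p).mpr ‹_›
    obtain ⟨x', hx'⟩ := exists_integersMap_eq R T N x
      ⟨x, (hTmem _).mpr fun t ht => congrArg Subtype.val (hx t ht)⟩ rfl
    obtain ⟨y, z, hyz⟩ := exists_eq_pow_add_mul (p := p) (irreducible_of_addVal_eq_one hπ'v) x' n
    have hfix : ∀ y : integralClosure R T, ∀ t ∈ H, t • integersMap R T N y = integersMap R T N y :=
      fun y t ht => Subtype.ext ((hTmem _).mp y.1.2 t ht)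
    exact ⟨integersMap R T N y, hfix y, integersMap R T N z, hfix z, by
      rw [← hx', hyz, map_add, map_mul, map_pow, hπ']⟩

/-- The depth on the quotient is the average of the depths over a coset of the kernel. -/
theorem card_mul_depth_eq_sum [PerfectField (ResidueField (integralClosure R F))]
    [PerfectField (ResidueField (integralClosure R N))] {p : ℕ} [Fact p.Prime] [CharP K p]
    [Fintype (inertiaRestrict R K F N).ker] (s : inertiaGroup R K N) :
    (Fintype.card (inertiaRestrict R K F N).ker : ℝ≥0∞) *
      (depth (integralClosure R F) (inertiaRestrict R K F N s : F ≃ₐ[K] F) : ℝ≥0∞) =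
        ∑ t : (inertiaRestrict R K F N).ker,
          (depth (integralClosure R N) ((s * t : inertiaGroup R K N) : N ≃ₐ[K] N) : ℝ≥0∞) := by
  have : CharP N p := (RingHom.charP_iff (algebraMap K N) (algebraMap K N).injective p).mp ‹_›
  have : CharP (integralClosure R N) p :=
    (RingHom.charP_iff (algebraMap (integralClosure R N) N) Subtype.val_injective p).mpr ‹_›
  have : CharP F p := (RingHom.charP_iff (algebraMap K F) (algebraMap K F).injective p).mp ‹_›
  have : CharP (integralClosure R F) p :=
    (RingHom.charP_iff (algebraMap (integralClosure R F) F) Subtype.val_injective p).mpr ‹_›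
  obtain ⟨π, hπ⟩ := exists_irreducible (integralClosure R F)
  obtain ⟨-, hcard, hD⟩ := inertiaRestrict_surjective_and_addVal R K F N hπ
  let e := (inertiaRestrict R K F N).ker.equivMapOfInjective _
      (Subgroup.subtype_injective (inertiaGroup R K N))
  have : Fintype (relInertia R K F N) := Fintype.ofFinite _
  have hc : Nat.card (relInertia R K F N) = Fintype.card (inertiaRestrict R K F N).ker := by
    rw [← Nat.card_eq_fintype_card]; exact (Nat.card_congr e.toEquiv).symm
  have h0 : addVal (integralClosure R N) (integersMap R F N π) ≠ 0 := by
    rw [hcard]; exact_mod_cast Nat.card_pos.ne'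
  have hfix : ∀ t ∈ relInertia R K F N, t • integersMap R F N π = integersMap R F N π :=
    fun t ht => Subtype.ext (relInertia_apply_algebraMap R K F N ht π)
  have key := sum_depth_add_one_eq (p := p) (relInertia_le R K F N) s.2 hfix
    (by rw [hcard, Nat.card_eq_fintype_card]) (fun x hx n => hD x hx p Fact.out ‹_› n)
  have h1 := addVal_map_eq_mul (integersMap R F N).toRingHom hπ h0
    ((inertiaRestrict R K F N s : F ≃ₐ[K] F) • π - π)
  change addVal _ (integersMap R F N _) = addVal _ (integersMap R F N π) * _ at h1
  rw [map_sub] at h1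
  have h2 : integersMap R F N ((inertiaRestrict R K F N s : F ≃ₐ[K] F) • π) =
      (s : N ≃ₐ[K] N) • integersMap R F N π := integersMap_restrictNormalHom_smul R K F N s π
  rw [h2, ← key, hcard, addVal_smul_sub (p := p) (inertiaRestrict R K F N s).2 hπ,
    ← e.toEquiv.sum_comp, Finset.sum_add_distrib, mul_add, Finset.sum_const, hc, Finset.card_univ,
    nsmul_eq_mul] at h1
  replace h1 := ENat.add_left_injective_of_ne_top (by
    rw [mul_one]; exact ENat.natCast_ne_top _) h1
  have h3 := congrArg ENat.toENNRealRingHom h1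
  rw [map_sum, map_mul, map_natCast] at h3
  exact h3.symm

/-- Herbrand's theorem: the upper numbering is compatible with quotients. -/
theorem mem_finiteUpperGroup_iff_exists {p : ℕ} [Fact p.Prime] [CharP K p] {v : ℝ} (hv : 0 ≤ v)
    (τ : F ≃ₐ[K] F) :
    τ ∈ finiteUpperGroup R K F v ↔
      ∃ s ∈ finiteUpperGroup R K N v, AlgEquiv.restrictNormalHom F s = τ := by
  classical
  have : CharP N p := (RingHom.charP_iff (algebraMap K N) (algebraMap K N).injective p).mp ‹_›
  have : CharP F p := (RingHom.charP_iff (algebraMap K F) (algebraMap K F).injective p).mp ‹_›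
  have : CharP (integralClosure R N) p :=
    (RingHom.charP_iff (algebraMap (integralClosure R N) N) Subtype.val_injective p).mpr ‹_›
  have := perfectField_residueField_integralClosure R K F
  have := perfectField_residueField_integralClosure R K N
  have : Fintype (inertiaGroup R K N) := Fintype.ofFinite _
  have : Fintype (inertiaGroup R K F) := Fintype.ofFinite _
  obtain ⟨π, hπ⟩ := exists_irreducible (integralClosure R F)
  have hsurj := (inertiaRestrict_surjective_and_addVal R K F N hπ).1
  have key := fun τ => le_herbrandSum_iff_exists (inertiaRestrict R K F N) hsurj
    (fun s => (depth (integralClosure R N) (s : N ≃ₐ[K] N) : ℝ≥0∞))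
    (fun s => (depth (integralClosure R F) (s : F ≃ₐ[K] F) : ℝ≥0∞))
    (fun s t => by
      rw [← ENat.toENNReal_min]
      exact ENat.toENNReal_le.mpr (min_depth_le_depth_mul (p := p) s.2 t.2))
    (fun s => by
      congr 1
      exact depth_inv (p := p) s.2)
    (card_mul_depth_eq_sum R K F N (p := p)) (ENNReal.ofReal v) τ
  constructor
  · intro h
    have hI := finiteUpperGroup_le_inertiaGroup (p := p) R K F v h
    obtain ⟨s, hs, hle⟩ := (key ⟨τ, hI⟩).mp
      ((mem_finiteUpperGroup_iff (p := p) R K F ⟨τ, hI⟩ hv).mp h)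
    exact ⟨s, (mem_finiteUpperGroup_iff (p := p) R K N s hv).mpr hle, congrArg Subtype.val hs⟩
  · rintro ⟨s, hs, rfl⟩
    have hI := finiteUpperGroup_le_inertiaGroup (p := p) R K N v hs
    exact (mem_finiteUpperGroup_iff (p := p) R K F (inertiaRestrict R K F N ⟨s, hI⟩) hv).mpr
      ((key _).mpr ⟨⟨s, hI⟩, rfl, (mem_finiteUpperGroup_iff (p := p) R K N ⟨s, hI⟩ hv).mp hs⟩)

end Herbrand

/-! ### Upper ramification groups of the absolute Galois group -/

section Absolute

open IsLocalRing
open IsDiscreteValuationRing hiding maximalIdeal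

variable {R K Ω : Type*} [CommRing R] [IsDomain R] [IsDiscreteValuationRing R]
  [PerfectField (ResidueField R)] [Field K] [Algebra R K] [IsFractionRing R K]
  [Field Ω] [Algebra K Ω] [Algebra R Ω] [IsScalarTower R K Ω] [IsGalois K Ω]
  [IsLocalRing (integralClosure R Ω)]
  {p : ℕ} [Fact p.Prime] [CharP K p]

theorem mem_upperGroup_iff {R K Ω : Type*} [CommRing R] [Field K] [Algebra R K]
    [Field Ω] [Algebra K Ω] [Algebra R Ω] [IsScalarTower R K Ω] {v : ℝ} {σ : Ω ≃ₐ[K] Ω} :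
    σ ∈ upperGroup R K Ω v ↔ ∀ F : FiniteGaloisIntermediateField K Ω,
      AlgEquiv.restrictNormalHom F σ ∈ finiteUpperGroup R K F v := by
  simp only [upperGroup, Subgroup.mem_iInf, Subgroup.mem_comap]

include p

theorem upperGroup_antitone {v w : ℝ} (hv : 0 ≤ v) (h : v ≤ w) :
    upperGroup R K Ω w ≤ upperGroup R K Ω v := by
  intro σ hσ
  rw [mem_upperGroup_iff] at hσ ⊢
  intro F
  have : IsLocalRing (integralClosure R F) := isLocalRing_integralClosure_of_tower R F Ω
  have : IsDiscreteValuationRing (integralClosure R F) :=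
    isDiscreteValuationRing_integralClosure R K F
  have := perfectField_residueField_integralClosure R K F
  have : CharP F p := (RingHom.charP_iff (algebraMap K F) (algebraMap K F).injective p).mp ‹_›
  have : Fintype (inertiaGroup R K F) := Fintype.ofFinite _
  exact finiteUpperGroup_antitone (p := p) R K F hv h (hσ F)

/-- Herbrand's theorem for two finite Galois subextensions `F ≤ N` of `Ω`. -/
theorem mem_finiteUpperGroup_iff_exists_restrict {v : ℝ} (hv : 0 ≤ v)
    {F N : FiniteGaloisIntermediateField K Ω} (h : F ≤ N) (τ : F ≃ₐ[K] F) :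
    τ ∈ finiteUpperGroup R K F v ↔
      ∃ σ : Ω ≃ₐ[K] Ω, AlgEquiv.restrictNormalHom N σ ∈ finiteUpperGroup R K N v ∧
        AlgEquiv.restrictNormalHom F σ = τ := by
  let _ : Algebra F N := (IntermediateField.inclusion h).toRingHom.toAlgebra
  have : IsScalarTower K F N := IsScalarTower.of_algebraMap_eq fun x => rfl
  have : IsScalarTower R F N := IsScalarTower.of_algebraMap_eq fun x => rfl
  have : IsScalarTower F N Ω := IsScalarTower.of_algebraMap_eq fun x => rfl
  have : IsLocalRing (integralClosure R F) := isLocalRing_integralClosure_of_tower R F Ω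
  have : IsLocalRing (integralClosure R N) := isLocalRing_integralClosure_of_tower R N Ω
  have : IsDiscreteValuationRing (integralClosure R F) :=
    isDiscreteValuationRing_integralClosure R K F
  have : IsDiscreteValuationRing (integralClosure R N) :=
    isDiscreteValuationRing_integralClosure R K N
  have hcomp : ∀ σ : Ω ≃ₐ[K] Ω, AlgEquiv.restrictNormalHom F (AlgEquiv.restrictNormalHom N σ) =
      AlgEquiv.restrictNormalHom F σ := by
    intro σ
    ext x
    have h1 := AlgEquiv.restrictNormal_commutes (AlgEquiv.restrictNormalHom N σ) F x
    have h2 := AlgEquiv.restrictNormal_commutes σ N (algebraMap F N x)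
    have h3 := AlgEquiv.restrictNormal_commutes σ F x
    have h4 := congrArg (algebraMap N Ω) h1
    exact h4.trans (h2.trans h3.symm)
  rw [mem_finiteUpperGroup_iff_exists R K F N (p := p) hv τ]
  constructor
  · rintro ⟨s, hs, rfl⟩
    obtain ⟨σ, rfl⟩ := AlgEquiv.restrictNormalHom_surjective (F := K) (K₁ := N) Ω s
    exact ⟨σ, hs, (hcomp σ).symm⟩
  · rintro ⟨σ, hs, rfl⟩
    exact ⟨_, hs, hcomp σ⟩

/-- Every element of an upper ramification group at finite level lifts to the upper ramification
group of the absolute Galois group, by compactness. -/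
theorem exists_mem_upperGroup_restrict {v : ℝ} (hv : 0 ≤ v)
    {F : FiniteGaloisIntermediateField K Ω} {τ : F ≃ₐ[K] F} (hτ : τ ∈ finiteUpperGroup R K F v) :
    ∃ σ ∈ upperGroup R K Ω v, AlgEquiv.restrictNormalHom F σ = τ := by
  have hclosed : ∀ (N : FiniteGaloisIntermediateField K Ω) (A : Set (N ≃ₐ[K] N)),
      IsClosed ((AlgEquiv.restrictNormalHom N : (Ω ≃ₐ[K] Ω) →* (N ≃ₐ[K] N)) ⁻¹' A) := fun N A =>
    (isClosed_discrete A).preimage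
      (InfiniteGalois.restrictNormalHom_continuous N.toIntermediateField)
  let C : {N : FiniteGaloisIntermediateField K Ω // F ≤ N} → Set (Ω ≃ₐ[K] Ω) := fun N =>
    {σ | AlgEquiv.restrictNormalHom N.1 σ ∈ finiteUpperGroup R K N.1 v ∧
      AlgEquiv.restrictNormalHom F σ = τ}
  have hCclosed : ∀ N, IsClosed (C N) := fun N =>
    (hclosed N.1 (finiteUpperGroup R K N.1 v : Set (N.1 ≃ₐ[K] N.1))).inter (hclosed F {τ})
  have hmono : ∀ N N', N.1 ≤ N'.1 → C N' ⊆ C N := fun N N' h σ hσ =>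
    ⟨(mem_finiteUpperGroup_iff_exists_restrict (p := p) hv h _).mpr ⟨σ, hσ.1, rfl⟩, hσ.2⟩
  have : Nonempty {N : FiniteGaloisIntermediateField K Ω // F ≤ N} := ⟨⟨F, le_rfl⟩⟩
  obtain ⟨σ, hσ⟩ := IsCompact.nonempty_iInter_of_directed_nonempty_isCompact_isClosed C
    (fun N N' => ⟨⟨N.1 ⊔ N'.1, N.2.trans le_sup_left⟩, hmono _ _ le_sup_left,
      hmono _ _ le_sup_right⟩)
    (fun N => (mem_finiteUpperGroup_iff_exists_restrict (p := p) hv N.2 τ).mp hτ)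
    (fun N => (hCclosed N).isCompact) hCclosed
  rw [Set.mem_iInter] at hσ
  refine ⟨σ, mem_upperGroup_iff.mpr fun N => ?_, (hσ ⟨F, le_rfl⟩).2⟩
  exact (mem_finiteUpperGroup_iff_exists_restrict (p := p) hv (le_sup_left : N ≤ N ⊔ F) _).mpr
    ⟨σ, (hσ ⟨N ⊔ F, le_sup_right⟩).1, rfl⟩

end Absolute

/-! ### Complete discrete valuation rings and change of base -/

section BaseField

open IsLocalRing
open IsDiscreteValuationRing hiding maximalIdeal

variable (R K Ω : Type*) [CommRing R] [IsDomain R] [IsDiscreteValuationRing R]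
  [Field K] [Algebra R K] [IsFractionRing R K]
  [Field Ω] [Algebra K Ω] [Algebra R Ω] [IsScalarTower R K Ω] [Algebra.IsSeparable K Ω]

include K in
/-- The integral closure of a complete discrete valuation ring in a separable algebraic extension
is local. -/
theorem isLocalRing_integralClosure_of_isSeparable [IsAdicComplete (maximalIdeal R) R] :
    IsLocalRing (integralClosure R Ω) := by
  refine IsLocalRing.of_isUnit_or_isUnit_one_sub_self fun a => ?_
  set F := IntermediateField.adjoin K {(a : Ω)}
  have : FiniteDimensional K F :=
    IntermediateField.adjoin.finiteDimensional (Algebra.IsIntegral.isIntegral (a : Ω))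
  have := isLocalRing_integralClosure_of_isAdicComplete R K F
  obtain ⟨z, hz⟩ := exists_integersMap_eq R F Ω a
    ⟨a, IntermediateField.mem_adjoin_simple_self K (a : Ω)⟩ rfl
  rw [← hz]
  rcases IsLocalRing.isUnit_or_isUnit_one_sub_self z with h | h
  · exact Or.inl (h.map _)
  · right
    have := h.map (integersMap R F Ω)
    rwa [map_sub, map_one] at this

end BaseField

section Retower

variable (A B N : Type*) [CommRing A] [CommRing B] [CommRing N] [Algebra A B] [Algebra A N]
  [Algebra B N] [IsScalarTower A B N] [Algebra.IsIntegral A B]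

/-- The integral closures of `A` and of an integral extension `B` of `A` agree. -/
def integersEquiv : integralClosure A N ≃+* integralClosure B N where
  toFun x := ⟨x, x.2.tower_top⟩
  invFun x := ⟨x, isIntegral_trans (R := A) x.1 x.2⟩
  map_mul' _ _ := rfl
  map_add' _ _ := rfl

theorem isLocalRing_integralClosure_of_isIntegral [IsLocalRing (integralClosure A N)] :
    IsLocalRing (integralClosure B N) :=
  (integersEquiv A B N).isLocalRing

end Retower

/-! ### Tame base change -/

section Tame

open scoped ENNReal
open IsLocalRing
open IsDiscreteValuationRing hiding maximalIdeal

section Transport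

theorem addVal_ringEquiv {S S' : Type*} [CommRing S] [IsDomain S] [IsDiscreteValuationRing S]
    [CommRing S'] [IsDomain S'] [IsDiscreteValuationRing S'] (ε : S ≃+* S') (x : S) :
    addVal S' (ε x) = addVal S x := by
  obtain ⟨ϖ, hϖ⟩ := exists_irreducible S
  have h : addVal S' (ε ϖ) = 1 := addVal_uniformizer ((MulEquiv.irreducible_iff ε).mpr hϖ)
  have h1 := addVal_map_eq_mul (ε : S →+* S') hϖ (by simp [h]) x
  simpa [h] using h1

theorem mem_inertia_iff_of_ringEquiv {S S' G G' : Type*} [CommRing S] [IsDomain S]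
    [IsDiscreteValuationRing S] [CommRing S'] [IsDomain S'] [IsDiscreteValuationRing S']
    [Group G] [MulSemiringAction G S] [Group G'] [MulSemiringAction G' S'] (ε : S ≃+* S')
    {s : G} {s' : G'} (h : ∀ x, ε (s • x) = s' • ε x) :
    s ∈ (maximalIdeal S).inertia G ↔ s' ∈ (maximalIdeal S').inertia G' := by
  have h1 : ∀ x, s • x - x ∈ maximalIdeal S ↔ s' • ε x - ε x ∈ maximalIdeal S' := fun x => by
    rw [mem_maximalIdeal_iff, mem_maximalIdeal_iff, ← h, ← map_sub, addVal_ringEquiv]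
  constructor
  · intro hs x
    have := (h1 (ε.symm x)).mp (hs _)
    rwa [RingEquiv.apply_symm_apply] at this
  · exact fun hs x => (h1 x).mpr (hs _)

theorem depth_eq_of_ringEquiv {S S' G G' : Type*} [CommRing S] [IsDomain S]
    [IsDiscreteValuationRing S] [CommRing S'] [IsDomain S'] [IsDiscreteValuationRing S']
    [Group G] [MulSemiringAction G S] [Group G'] [MulSemiringAction G' S']
    [PerfectField (ResidueField S)] [PerfectField (ResidueField S')] {p : ℕ} [Fact p.Prime]
    [CharP S p] [CharP S' p] (ε : S ≃+* S')
    {s : G} {s' : G'} (h : ∀ x, ε (s • x) = s' • ε x) (hs : s ∈ (maximalIdeal S).inertia G) :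
    depth S s = depth S' s' := by
  obtain ⟨ϖ, hϖ⟩ := exists_irreducible S
  have h1 := addVal_smul_sub (p := p) hs hϖ
  have h2 := addVal_smul_sub (p := p) ((mem_inertia_iff_of_ringEquiv ε h).mp hs)
    ((MulEquiv.irreducible_iff ε).mpr hϖ)
  rw [← h, ← map_sub, addVal_ringEquiv, h1] at h2
  exact ENat.add_left_injective_of_ne_top ENat.one_ne_top h2

end Transport

/-- Wild inertia fixes every element that has a fixed power with exponent prime to the residue
characteristic: the quotient `s x / x` is a root of unity congruent to `1`. -/
theorem smul_eq_self_of_pow {S G : Type*} [CommRing S] [IsDomain S]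
    [IsDiscreteValuationRing S] [Group G] [MulSemiringAction G S]
    [PerfectField (ResidueField S)] {p : ℕ} [Fact p.Prime] [CharP S p] {s : G}
    (hs : s ∈ (maximalIdeal S).inertia G) (hd : 1 ≤ depth S s) {e : ℕ} (he : e.Coprime p) {x : S}
    (hx : s • x ^ e = x ^ e) : s • x = x := by
  rcases eq_or_ne x 0 with rfl | hx0
  · simp
  obtain ⟨ω, hω⟩ := exists_irreducible S
  obtain ⟨k, η, hk⟩ := eq_unit_mul_pow_irreducible hx0 hω
  obtain ⟨c, hc⟩ : ω * ω ∣ s • ω - ω := by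
    rw [← addVal_le_iff_dvd, addVal_mul, addVal_uniformizer hω, addVal_smul_sub (p := p) hs hω]
    gcongr
  have hωm : ω ∈ maximalIdeal S := (mem_maximalIdeal _).mpr hω.not_isUnit
  obtain ⟨ζ, hζ, hζm⟩ : ∃ ζ, s • x = x * ζ ∧ ζ - 1 ∈ maximalIdeal S := by
    have hη : s • (η : S) - η ∈ maximalIdeal S := hs η
    refine ⟨(1 + ↑η⁻¹ * (s • (η : S) - η)) * (1 + ω * c) ^ k, ?_, ?_⟩
    · have h1 : s • ω = ω * (1 + ω * c) := by linear_combination hc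
      have h2 : s • (η : S) = η * (1 + ↑η⁻¹ * (s • (η : S) - η)) := by
        rw [mul_add, Units.mul_inv_cancel_left]; ring
      rw [hk, smul_mul', smul_pow', h1, mul_pow]
      nth_rw 1 [h2]
      ring
    · rw [← Ideal.Quotient.eq] at hη ⊢
      have h3 : Ideal.Quotient.mk (maximalIdeal S) ω = 0 := Ideal.Quotient.eq_zero_iff_mem.mpr hωm
      simp only [map_mul, map_add, map_one, map_pow, map_sub, hη, sub_self, mul_zero, add_zero, h3,
        zero_mul, one_pow, mul_one]
  have hpow : ζ ^ e = 1 := by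
    rw [smul_pow', hζ, mul_pow] at hx
    exact mul_left_cancel₀ (pow_ne_zero e hx0) (hx.trans (mul_one _).symm)
  have hunit : IsUnit (∑ i ∈ Finset.range e, ζ ^ i) := by
    by_contra hn
    have h1 : Ideal.Quotient.mk (maximalIdeal S) ζ = 1 := by
      rw [← map_one (Ideal.Quotient.mk (maximalIdeal S)), Ideal.Quotient.eq]; exact hζm
    have h2 : Ideal.Quotient.mk (maximalIdeal S) (∑ i ∈ Finset.range e, ζ ^ i) = 0 :=
      Ideal.Quotient.eq_zero_iff_mem.mpr ((mem_maximalIdeal _).mpr hn)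
    simp only [map_sum, map_pow, h1, one_pow, Finset.sum_const, Finset.card_range, nsmul_eq_mul,
      mul_one] at h2
    rw [← map_natCast (Ideal.Quotient.mk (maximalIdeal S)), Ideal.Quotient.eq_zero_iff_mem] at h2
    obtain ⟨a, b, hab⟩ := (Nat.isCoprime_iff_coprime.mpr he)
    have h3 : (1 : S) = a * e + b * p := by exact_mod_cast congrArg (Int.cast : ℤ → S) hab.symm
    rw [CharP.cast_eq_zero S p, mul_zero, add_zero] at h3
    exact (Ideal.ne_top_iff_one _).mp (maximalIdeal.isMaximal S).ne_top
      (h3 ▸ Ideal.mul_mem_left _ _ h2)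
  have h0 : (∑ i ∈ Finset.range e, ζ ^ i) * (ζ - 1) = 0 := by
    rw [geom_sum_mul, hpow, sub_self]
  have hζ1 : ζ = 1 := sub_eq_zero.mp ((mul_eq_zero.mp h0).resolve_left hunit.ne_zero)
  rw [hζ, hζ1, mul_one]

/-- Upper numbering is multiplied by the ramification index under a totally tamely ramified
extension of the base generated by a root of a uniformizer. -/
theorem mem_finiteUpperGroup_of_tame (R K A L N : Type*) [CommRing R] [IsDomain R]
    [IsDiscreteValuationRing R] [PerfectField (ResidueField R)] [Field K] [Algebra R K]
    [IsFractionRing R K] [CommRing A] [IsDomain A] [IsDiscreteValuationRing A]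
    [PerfectField (ResidueField A)] [Field L] [Algebra A L] [IsFractionRing A L] [Field N]
    [Algebra K L] [Algebra K N] [Algebra L N] [IsScalarTower K L N] [Algebra R N]
    [IsScalarTower R K N] [Algebra A N] [IsScalarTower A L N] [Algebra R A] [IsScalarTower R A N]
    [Algebra.IsIntegral R A]
    [FiniteDimensional K N] [IsGalois K N] [FiniteDimensional L N] [IsGalois L N]
    [IsDiscreteValuationRing (integralClosure R N)] {p : ℕ} [Fact p.Prime] [CharP K p]
    {e : ℕ} (he : e.Coprime p) {π : R} (hπ : Irreducible π) {ϖ : A} (hϖ : Irreducible ϖ)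
    (hpow : ϖ ^ e = algebraMap R A π)
    (hgen : ∀ s : N ≃ₐ[K] N, s (algebraMap A N ϖ) = algebraMap A N ϖ →
      ∀ x : L, s (algebraMap L N x) = algebraMap L N x)
    {q : ℝ} (hq : 0 < q) {s : N ≃ₐ[K] N} (hs : s ∈ finiteUpperGroup R K N q) :
    ∃ s' ∈ finiteUpperGroup A L N (e * q), ∀ x, s' x = s x := by
  classical
  set ε := integersEquiv R A N
  have : IsDiscreteValuationRing (integralClosure A N) :=
    IsDiscreteValuationRing.RingEquivClass.isDiscreteValuationRing ε
  have := perfectField_residueField_integralClosure R K N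
  have := perfectField_residueField_integralClosure A L N
  have : CharP N p := (RingHom.charP_iff (algebraMap K N) (algebraMap K N).injective p).mp ‹_›
  have : CharP (integralClosure R N) p :=
    (RingHom.charP_iff (algebraMap (integralClosure R N) N) Subtype.val_injective p).mpr ‹_›
  have : CharP (integralClosure A N) p :=
    (RingHom.charP_iff (algebraMap (integralClosure A N) N) Subtype.val_injective p).mpr ‹_›
  have : Fintype (inertiaGroup R K N) := Fintype.ofFinite _
  have : Fintype (inertiaGroup A L N) := Fintype.ofFinite _
  let ι : (N ≃ₐ[L] N) → (N ≃ₐ[K] N) := fun s' => s'.restrictScalars K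
  have hι : ∀ (s' : N ≃ₐ[L] N) x, ε (ι s' • x) = s' • ε x := fun s' x => rfl
  -- Elements of positive depth fix `L`.
  have hpos : ∀ s ∈ inertiaGroup R K N, depth (integralClosure R N) s ≠ 0 → ∃ s', ι s' = s := by
    intro s hsI hd
    have h1 : s • ε.symm (algebraMap A (integralClosure A N) ϖ) =
        ε.symm (algebraMap A (integralClosure A N) ϖ) := by
      refine smul_eq_self_of_pow (p := p) hsI (Order.one_le_iff_ne_zero.mpr hd) he ?_
      apply Subtype.ext
      change s ((algebraMap A N ϖ) ^ e) = (algebraMap A N ϖ) ^ e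
      rw [← map_pow, hpow, ← IsScalarTower.algebraMap_apply R A N,
        IsScalarTower.algebraMap_apply R K N, s.commutes]
    have h2 := hgen s (congrArg Subtype.val h1)
    exact ⟨AlgEquiv.ofRingEquiv (f := s.toRingEquiv) h2, AlgEquiv.ext fun x => rfl⟩
  have hsI := finiteUpperGroup_le_inertiaGroup (p := p) R K N q hs
  have hle := (mem_finiteUpperGroup_iff (p := p) R K N ⟨s, hsI⟩ hq.le).mp hs
  have hcard : Fintype.card (inertiaGroup R K N) = e * Fintype.card (inertiaGroup A L N) := by
    have h1 := addVal_algebraMap_eq_card_inertiaGroup R K N hπ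
    have h2 := addVal_algebraMap_eq_card_inertiaGroup A L N hϖ
    have h3 : ε (algebraMap R (integralClosure R N) π) =
        (algebraMap A (integralClosure A N) ϖ) ^ e := by
      apply Subtype.ext
      change algebraMap R N π = (algebraMap A N ϖ) ^ e
      rw [← map_pow, hpow, ← IsScalarTower.algebraMap_apply]
    rw [← addVal_ringEquiv ε, h3, addVal_pow, h2, nsmul_eq_mul] at h1
    rw [← Nat.card_eq_fintype_card, ← Nat.card_eq_fintype_card]
    exact_mod_cast h1.symm
  have hd0 : depth (integralClosure R N) s ≠ 0 := by
    intro h0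
    simp only [h0, herbrandSum, ENat.toENNReal_zero, min_zero, Finset.sum_const_zero,
      nonpos_iff_eq_zero, mul_eq_zero, ENNReal.ofReal_eq_zero, not_le.mpr hq, false_or] at hle
    exact Fintype.card_ne_zero (Nat.cast_eq_zero.mp hle)
  obtain ⟨s', rfl⟩ := hpos s hsI hd0
  have hI : ∀ s', ι s' ∈ inertiaGroup R K N ↔ s' ∈ inertiaGroup A L N := fun s' =>
    mem_inertia_iff_of_ringEquiv ε (hι s')
  have hdepth : ∀ s', ι s' ∈ inertiaGroup R K N →
      depth (integralClosure R N) (ι s') = depth (integralClosure A N) s' := fun s' h =>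
    depth_eq_of_ringEquiv (p := p) ε (hι s') h
  refine ⟨s', (mem_finiteUpperGroup_iff (p := p) A L N ⟨s', (hI s').mp hsI⟩ (by positivity)).mpr ?_,
    fun x => rfl⟩
  have hsum : ∀ u, herbrandSum (fun s : inertiaGroup A L N =>
      (depth (integralClosure A N) (s : N ≃ₐ[L] N) : ℝ≥0∞)) u =
      herbrandSum (fun s : inertiaGroup R K N =>
        (depth (integralClosure R N) (s : N ≃ₐ[K] N) : ℝ≥0∞)) u := by
    intro u
    refine Fintype.sum_of_injective
      (fun t : inertiaGroup A L N => (⟨ι t, (hI t).mpr t.2⟩ : inertiaGroup R K N)) ?_ _ _ ?_ ?_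
    · intro t t' h
      exact Subtype.ext (AlgEquiv.restrictScalars_injective K (congrArg Subtype.val h))
    · intro t ht
      have : depth (integralClosure R N) (t : N ≃ₐ[K] N) = 0 := by
        by_contra hne
        obtain ⟨t', ht'⟩ := hpos t t.2 hne
        exact ht ⟨⟨t', (hI t').mp (ht' ▸ t.2)⟩, Subtype.ext ht'⟩
      simp [this]
    · intro t
      simp only [hdepth t ((hI t).mpr t.2)]
  rw [hsum, ← hdepth s' hsI]
  refine le_trans (le_of_eq ?_) hle
  rw [hcard, ENNReal.ofReal_mul (by positivity), ENNReal.ofReal_natCast]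
  push_cast
  ring

end Tame

/-! ### Totally tamely ramified extensions inside a separable closure -/

section TameAbsolute

open IsLocalRing
open IsDiscreteValuationRing hiding maximalIdeal

variable (R K Ω : Type*) [CommRing R] [IsDomain R] [IsDiscreteValuationRing R]
  [Field K] [Algebra R K] [IsFractionRing R K]
  [Field Ω] [Algebra K Ω] [Algebra R Ω] [IsScalarTower R K Ω]
  (p : ℕ) [Fact p.Prime] [CharP K p]

/-- Adjoining an `e`-th root of a uniformizer, `e` prime to `p`, gives a totally tamely ramified
extension of degree `e` in which the root is a uniformizer. -/
theorem exists_totallyTamelyRamified [IsSepClosure K Ω] [IsLocalRing (integralClosure R Ω)]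
    {e : ℕ} (he : e.Coprime p) (he0 : e ≠ 0) {π : R} (hπ : Irreducible π) :
    ∃ L : IntermediateField K Ω, ∃ ϖ : integralClosure R L,
      IsTotallyTamelyRamified R p L ∧ Module.finrank K L = e ∧
      IsDiscreteValuationRing (integralClosure R L) ∧ Irreducible ϖ ∧
      ϖ ^ e = algebraMap R (integralClosure R L) π ∧
      L = IntermediateField.adjoin K {((ϖ : L) : Ω)} := by
  have : Algebra.IsSeparable K Ω := IsSepClosure.separable
  have : IsSepClosed Ω := IsSepClosure.sep_closed K
  have : CharP Ω p := (RingHom.charP_iff (algebraMap K Ω) (algebraMap K Ω).injective p).mp ‹_›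
  have : NeZero (e : Ω) := ⟨fun h => by
    rw [CharP.cast_eq_zero_iff Ω p] at h
    exact (Fact.out : p.Prime).one_lt.ne' (Nat.Coprime.eq_one_of_dvd he.symm h)⟩
  obtain ⟨x, hx⟩ := IsSepClosed.exists_pow_nat_eq (algebraMap R Ω π) e
  set L := IntermediateField.adjoin K {x} with hL
  have hxint : IsIntegral K x := Algebra.IsIntegral.isIntegral x
  have : FiniteDimensional K L := IntermediateField.adjoin.finiteDimensional hxint
  have : IsLocalRing (integralClosure R L) := isLocalRing_integralClosure_of_tower R L Ω
  have : IsDiscreteValuationRing (integralClosure R L) :=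
    isDiscreteValuationRing_integralClosure R K L
  have := finite_integralClosure R K L
  have := faithfulSMul_integralClosure R K L
  let y : L := ⟨x, IntermediateField.mem_adjoin_simple_self K x⟩
  have hy : y ^ e = algebraMap R L π := Subtype.ext hx
  let ϖ : integralClosure R L := ⟨y, IsIntegral.of_pow (Nat.pos_of_ne_zero he0)
    (hy ▸ isIntegral_algebraMap)⟩
  have hϖ : ϖ ^ e = algebraMap R (integralClosure R L) π := Subtype.ext hy
  have hle : Module.finrank K L ≤ e := by
    rw [hL, IntermediateField.adjoin.finrank hxint]
    have hm : (Polynomial.X ^ e - Polynomial.C (algebraMap R K π)).Monic :=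
      Polynomial.monic_X_pow_sub_C _ he0
    have h1 := Polynomial.natDegree_le_of_dvd (minpoly.dvd K x
      (p := Polynomial.X ^ e - Polynomial.C (algebraMap R K π)) (by
        simp [hx, ← IsScalarTower.algebraMap_apply])) hm.ne_zero
    rwa [Polynomial.natDegree_X_pow_sub_C] at h1
  have hval : (e : ℕ∞) * addVal (integralClosure R L) ϖ ≤ Module.finrank K L := by
    have h1 := addVal_algebraMap_le_finrank (B := integralClosure R L) hπ
    rwa [finrank_integralClosure R K L, ← hϖ, addVal_pow, nsmul_eq_mul] at h1
  have hpos : addVal (integralClosure R L) ϖ ≠ 0 := by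
    rw [Ne, addVal_eq_zero_iff]
    intro hu
    have h1 := hu.pow e
    rw [hϖ] at h1
    exact hπ.not_isUnit (isUnit_of_map_unit (algebraMap R (integralClosure R L)) π h1)
  obtain ⟨m, hm⟩ : ∃ m : ℕ, addVal (integralClosure R L) ϖ = m := by
    refine ENat.ne_top_iff_exists.mp ?_ |>.imp fun m h => h.symm
    intro h
    rw [h, ENat.mul_top (by exact_mod_cast he0)] at hval
    exact ENat.natCast_ne_top _ (top_le_iff.mp hval)
  rw [hm] at hval hpos
  have hval' : e * m ≤ Module.finrank K L := by exact_mod_cast hval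
  have hm0 : m ≠ 0 := by exact_mod_cast hpos
  have hm1 : m = 1 := by
    have h1 : e * m ≤ e * 1 := by simpa using hval'.trans hle
    have h2 := Nat.le_of_mul_le_mul_left h1 (Nat.pos_of_ne_zero he0)
    omega
  have hdeg : Module.finrank K L = e := le_antisymm hle (by simpa [hm1] using hval')
  have hirr : Irreducible ϖ := irreducible_of_addVal_eq_one (by rw [hm, hm1, Nat.cast_one])
  refine ⟨L, ϖ, ⟨inferInstance, ?_, hdeg ▸ he⟩, hdeg, inferInstance, hirr, hϖ, rfl⟩
  rw [maxIdeal_eq, hπ.maximalIdeal_eq, Ideal.map_span, Set.image_singleton, ← hϖ,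
    hirr.maximalIdeal_eq, Ideal.span_singleton_pow, hdeg]

variable [PerfectField (ResidueField R)] [IsGalois K Ω] [IsLocalRing (integralClosure R Ω)]

variable {R K Ω p} in
/-- `G_K^q ⊆ G_L^{eq}` when `L` is generated by an `e`-th root of a uniformizer, `e` prime to
`p`. -/
theorem exists_mem_upperGroup_of_tame {e : ℕ} (he : e.Coprime p) {π : R} (hπ : Irreducible π)
    {L : IntermediateField K Ω} [FiniteDimensional K L]
    [IsDiscreteValuationRing (integralClosure R L)] {ϖ : integralClosure R L} (hϖ : Irreducible ϖ)
    (hpow : ϖ ^ e = algebraMap R (integralClosure R L) π)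
    (hgen : L = IntermediateField.adjoin K {((ϖ : L) : Ω)}) {q : ℝ} (hq : 0 < q)
    {σ : Ω ≃ₐ[K] Ω} (hσ : σ ∈ upperGroup R K Ω q) :
    ∃ σ' ∈ upperGroup (integralClosure R L) L Ω (e * q), σ'.restrictScalars K = σ := by
  let A := integralClosure R L
  have : IsFractionRing A L := integralClosure.isFractionRing_of_finite_extension K L
  have : PerfectField (ResidueField A) := perfectField_residueField_integralClosure R K L
  have : CharP L p := (RingHom.charP_iff (algebraMap K L) (algebraMap K L).injective p).mp ‹_›
  have : IsScalarTower R A Ω := IsScalarTower.of_algebraMap_eq fun x => rfl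
  have : IsLocalRing (integralClosure A Ω) := isLocalRing_integralClosure_of_isIntegral R A Ω
  rw [mem_upperGroup_iff] at hσ
  -- Every finite Galois extension of `L` lies in a finite Galois extension of `K`.
  have key : ∀ F : FiniteGaloisIntermediateField L Ω, (∀ x : L, σ x = x) ∧
      ∀ σ' : Ω ≃ₐ[L] Ω, (∀ x, σ' x = σ x) →
        AlgEquiv.restrictNormalHom F σ' ∈ finiteUpperGroup A L F (e * q) := by
    intro F
    set F₀ : IntermediateField K Ω := F.toIntermediateField.restrictScalars K
    have hLF : L ≤ F₀ := fun x hx => F.toIntermediateField.algebraMap_mem ⟨x, hx⟩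
    have : FiniteDimensional K F₀ := Module.Finite.trans (R := K) L F
    set N : IntermediateField K Ω := IntermediateField.normalClosure K F₀ Ω
    have hFN : F₀ ≤ N := IntermediateField.le_normalClosure F₀
    have hLN : L ≤ N := hLF.trans hFN
    let _ : Algebra L N := (IntermediateField.inclusion hLN).toRingHom.toAlgebra
    let _ : Algebra F N := (IntermediateField.inclusion hFN).toRingHom.toAlgebra
    have : FiniteDimensional K N := inferInstance
    have : IsGalois K N := inferInstance
    have : IsScalarTower K L N := IsScalarTower.of_algebraMap_eq fun x => rfl
    have : IsScalarTower L F N := IsScalarTower.of_algebraMap_eq fun x => rfl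
    have : IsScalarTower A L N := IsScalarTower.of_algebraMap_eq fun x => rfl
    have : IsScalarTower A F N := IsScalarTower.of_algebraMap_eq fun x => rfl
    have : IsScalarTower R A N := IsScalarTower.of_algebraMap_eq fun x => rfl
    have : IsScalarTower L N Ω := IsScalarTower.of_algebraMap_eq fun x => rfl
    have : IsScalarTower F N Ω := IsScalarTower.of_algebraMap_eq fun x => rfl
    have : FiniteDimensional L N := Module.Finite.of_restrictScalars_finite K L N
    have : IsGalois L N := IsGalois.tower_top_of_isGalois K L N
    have : IsLocalRing (integralClosure R N) := isLocalRing_integralClosure_of_tower R N Ω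
    have : IsDiscreteValuationRing (integralClosure R N) :=
      isDiscreteValuationRing_integralClosure R K N
    have : IsLocalRing (integralClosure A N) := isLocalRing_integralClosure_of_tower A N Ω
    have : IsDiscreteValuationRing (integralClosure A N) :=
      isDiscreteValuationRing_integralClosure A L N
    have : IsLocalRing (integralClosure A F) := isLocalRing_integralClosure_of_tower A F Ω
    have : IsDiscreteValuationRing (integralClosure A F) :=
      isDiscreteValuationRing_integralClosure A L F
    have hgenN : ∀ s : N ≃ₐ[K] N, s (algebraMap A N ϖ) = algebraMap A N ϖ →
        ∀ x : L, s (algebraMap L N x) = algebraMap L N x := by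
      intro s hs x
      have : (s : N →ₐ[K] N).comp (IsScalarTower.toAlgHom K L N) =
          IsScalarTower.toAlgHom K L N := by
        refine IntermediateField.algHom_ext_of_eq_adjoin K hgen ?_
        rintro x rfl
        exact hs
      exact DFunLike.congr_fun this x
    obtain ⟨s', hs', hs'σ⟩ := mem_finiteUpperGroup_of_tame R K A L N he hπ hϖ hpow hgenN hq
      (hσ (FiniteGaloisIntermediateField.mk N))
    have hs : ∀ x : N, ((s' x : N) : Ω) = σ x := fun x =>
      (congrArg Subtype.val (hs'σ x)).trans (AlgEquiv.restrictNormal_commutes σ N x)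
    refine ⟨fun x => ?_, fun σ' hσ' => ?_⟩
    · exact (hs _).symm.trans (congrArg (algebraMap N Ω) (s'.commutes x))
    · rw [mem_finiteUpperGroup_iff_exists A L F N (p := p) (by positivity)]
      refine ⟨s', hs', AlgEquiv.ext fun x => Subtype.ext ?_⟩
      have h1 := congrArg (algebraMap N Ω) (AlgEquiv.restrictNormal_commutes s' F x)
      exact h1.trans ((hs _).trans ((hσ' _).symm.trans
        (AlgEquiv.restrictNormal_commutes σ' F x).symm))
  have hfix : ∀ x : L, σ x = x := (key ⊥).1
  refine ⟨AlgEquiv.ofRingEquiv (f := σ.toRingEquiv) hfix, ?_, AlgEquiv.ext fun x => rfl⟩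
  rw [mem_upperGroup_iff]
  exact fun F => (key F).2 _ fun x => rfl

end TameAbsolute

/-! ### Artin–Schreier characters -/

section ArtinSchreier

open scoped ENNReal
open IsLocalRing
open IsDiscreteValuationRing hiding maximalIdeal

/-- The depth of a nontrivial automorphism `y ↦ y + c` of an Artin–Schreier extension
`y ^ p - y = π ^ (-n)`, in terms of `w = 1 / y`: with `α * n = 1 + β * p`, the element
`w ^ α / π ^ β` is a uniformizer, and it is divided by `(1 + c w) ^ α`. -/
theorem depth_eq_of_artinSchreier {S G : Type*} [CommRing S] [IsDomain S]
    [IsDiscreteValuationRing S] [PerfectField (ResidueField S)] [Group G] [MulSemiringAction G S]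
    {p : ℕ} [Fact p.Prime] [CharP S p] {n : ℕ} (hn : n.Coprime p) {w π c : S} (hc : IsUnit c)
    (hw : addVal S w = n) (hn0 : n ≠ 0) (hπ : addVal S π = p) {s : G}
    (hs : s ∈ (maximalIdeal S).inertia G) (hsπ : s • π = π) (hsw : s • w * (1 + c * w) = w) :
    depth S s = n := by
  have hp : p.Prime := Fact.out
  obtain ⟨α, -, hα⟩ := Nat.exists_mul_mod_eq_one_of_coprime hn hp.one_lt
  set β := n * α / p
  have hαβ : n * α = 1 + β * p := by rw [← hα, mul_comm β, Nat.mod_add_div]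
  have hπ0 : π ≠ 0 := by
    rintro rfl
    rw [addVal_zero] at hπ
    exact ENat.natCast_ne_top p hπ.symm
  have hw0 : w ≠ 0 := by
    rintro rfl
    rw [addVal_zero] at hw
    exact ENat.natCast_ne_top n hw.symm
  have hwm : w ∈ maximalIdeal S := by
    rw [mem_maximalIdeal_iff, hw]
    exact_mod_cast Nat.one_le_iff_ne_zero.mpr hn0
  obtain ⟨ω, hω⟩ : π ^ β ∣ w ^ α := by
    rw [← addVal_le_iff_dvd, addVal_pow, addVal_pow, hπ, hw, nsmul_eq_mul, nsmul_eq_mul]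
    have : β * p ≤ α * n := by rw [mul_comm α, hαβ]; omega
    exact_mod_cast this
  have hω1 : addVal S ω = 1 := by
    have h1 := congrArg (addVal S) hω
    rw [addVal_mul, addVal_pow, addVal_pow, hπ, hw, nsmul_eq_mul, nsmul_eq_mul] at h1
    have h2 : (α : ℕ∞) * n = (β * p : ℕ) + 1 := by
      rw [mul_comm]; exact_mod_cast hαβ.trans (add_comm _ _)
    rw [h2, Nat.cast_mul] at h1
    exact ENat.add_right_injective_of_ne_top (n := (β : ℕ∞) * p)
      (by exact_mod_cast ENat.natCast_ne_top (β * p)) h1.symm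
  have hirr := irreducible_of_addVal_eq_one hω1
  have hsω : s • ω * (1 + c * w) ^ α = ω := by
    apply mul_left_cancel₀ (pow_ne_zero β hπ0)
    have h1 := congrArg (s • ·) hω
    simp only [smul_mul', smul_pow', hsπ] at h1
    rw [← mul_assoc, ← h1, ← mul_pow, hsw, hω]
  have hunit : ∀ z ∈ maximalIdeal S, IsUnit (1 + z) := fun z hz => by
    by_contra h
    have h1 : 1 + z - z ∈ maximalIdeal S := sub_mem ((mem_maximalIdeal _).mpr h) hz
    rw [add_sub_cancel_right] at h1
    exact (Ideal.ne_top_iff_one _).mp (maximalIdeal.isMaximal S).ne_top h1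
  have hcw : c * w ∈ maximalIdeal S := Ideal.mul_mem_left _ _ hwm
  have hsum : IsUnit (∑ i ∈ Finset.range α, (1 + c * w) ^ i) := by
    by_contra hnu
    have h0 : Ideal.Quotient.mk (maximalIdeal S) (c * w) = 0 :=
      Ideal.Quotient.eq_zero_iff_mem.mpr hcw
    have h2 : Ideal.Quotient.mk (maximalIdeal S) (∑ i ∈ Finset.range α, (1 + c * w) ^ i) = 0 :=
      Ideal.Quotient.eq_zero_iff_mem.mpr ((mem_maximalIdeal _).mpr hnu)
    simp only [map_sum, map_pow, map_add, map_one, h0, add_zero, one_pow, Finset.sum_const,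
      Finset.card_range, nsmul_eq_mul, mul_one] at h2
    rw [← map_natCast (Ideal.Quotient.mk (maximalIdeal S)), Ideal.Quotient.eq_zero_iff_mem] at h2
    have h3 : (n : S) * α = 1 := by
      have := congrArg (Nat.cast : ℕ → S) hαβ
      push_cast at this
      rwa [CharP.cast_eq_zero S p, mul_zero, add_zero] at this
    exact (Ideal.ne_top_iff_one _).mp (maximalIdeal.isMaximal S).ne_top
      (h3 ▸ Ideal.mul_mem_left _ _ h2)
  have hval : addVal S (s • ω - ω) = n + 1 := by
    have h1 : (s • ω - ω) * (1 + c * w) ^ α =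
        -(ω * ((∑ i ∈ Finset.range α, (1 + c * w) ^ i) * (c * w))) := by
      have h2 := geom_sum_mul (1 + c * w) α
      rw [add_sub_cancel_left] at h2
      rw [h2, sub_mul, hsω]
      ring
    have h2 := congrArg (addVal S) h1
    rwa [← neg_mul, addVal_mul, addVal_mul, addVal_mul, addVal_mul,
      addVal_eq_zero_iff.mpr ((hunit _ hcw).pow α), addVal_eq_zero_iff.mpr hsum,
      addVal_eq_zero_iff.mpr hc, addVal_eq_of_associated (Associated.neg_left (Associated.refl ω)),
      hω1, hw, add_zero, zero_add, zero_add, add_comm] at h2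
  rw [addVal_smul_sub (p := p) hs hirr] at hval
  exact ENat.add_left_injective_of_ne_top ENat.one_ne_top hval

variable {R K Ω : Type*} [CommRing R] [IsDomain R] [IsDiscreteValuationRing R]
  [Field K] [Algebra R K] [IsFractionRing R K]
  [Field Ω] [Algebra K Ω] [Algebra R Ω] [IsScalarTower R K Ω]
  {p : ℕ} [Fact p.Prime] [CharP K p]

variable (Ω p) in
/-- The Artin–Schreier extension `y ^ p - y = a` inside a separable closure, with the injective
homomorphism `σ ↦ σ y - y` from its Galois group to `ZMod p`. The element `σ y - y` of the prime
field of `F` is given by its natural number representatives. -/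
theorem exists_artinSchreier_extension [IsSepClosed Ω] [IsGalois K Ω] (a : K) :
    ∃ F : FiniteGaloisIntermediateField K Ω, ∃ y : F, y ^ p - y = algebraMap K F a ∧
      ∃ c : (F ≃ₐ[K] F) →* Multiplicative (ZMod p), Function.Injective c ∧
        ∀ s, ∀ m : ℕ, ((c s).toAdd : ZMod p) = m → s y = y + m := by
  have hp : p.Prime := Fact.out
  have : CharP Ω p := (RingHom.charP_iff (algebraMap K Ω) (algebraMap K Ω).injective p).mp ‹_›
  obtain ⟨y, hy⟩ : ∃ y : Ω, y ^ p - y = algebraMap K Ω a := by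
    have hdeg : (Polynomial.X ^ p - (Polynomial.X + Polynomial.C (algebraMap K Ω a))).degree =
        (p : WithBot ℕ) := by
      rw [Polynomial.degree_sub_eq_left_of_degree_lt, Polynomial.degree_X_pow]
      rw [Polynomial.degree_X_add_C, Polynomial.degree_X_pow]
      exact_mod_cast hp.one_lt
    obtain ⟨y, hy⟩ := IsSepClosed.exists_root
      (Polynomial.X ^ p - (Polynomial.X + Polynomial.C (algebraMap K Ω a)))
      (by rw [hdeg]; exact_mod_cast hp.ne_zero)
      ⟨0, -1, by simp [Polynomial.derivative_X_pow]⟩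
    refine ⟨y, ?_⟩
    simp only [Polynomial.IsRoot.def, Polynomial.eval_sub, Polynomial.eval_add, Polynomial.eval_pow,
      Polynomial.eval_X, Polynomial.eval_C] at hy
    linear_combination hy
  set F := IntermediateField.adjoin K {y}
  have hyF : y ∈ F := IntermediateField.mem_adjoin_simple_self K y
  have : FiniteDimensional K F :=
    IntermediateField.adjoin.finiteDimensional (Algebra.IsIntegral.isIntegral y)
  have hroot : ∀ z : Ω, z ^ p = z → ∃ c : ZMod p, ZMod.castHom (dvd_refl p) Ω c = z := by
    intro z hz
    rw [← Subfield.mem_bot_iff_pow_eq_self Ω p] at hz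
    exact (bot_le : (⊥ : Subfield Ω) ≤ (ZMod.castHom (dvd_refl p) Ω).fieldRange) hz
  have hconj : ∀ σ : Ω ≃ₐ[K] Ω, ∃ c : ZMod p, σ y = y + ZMod.castHom (dvd_refl p) Ω c := by
    intro σ
    obtain ⟨c, hc⟩ := hroot (σ y - y) (by
      have h1 := congrArg σ hy
      rw [map_sub, map_pow, AlgEquiv.commutes, ← hy] at h1
      rw [sub_pow_char]
      linear_combination h1)
    exact ⟨c, by rw [hc]; ring⟩
  have : Normal K F := by
    rw [IntermediateField.normal_iff_forall_map_le']
    intro σ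
    rw [IntermediateField.adjoin_map, Set.image_singleton, IntermediateField.adjoin_simple_le_iff]
    obtain ⟨c, hc⟩ := hconj σ
    change σ y ∈ F
    rw [hc, ← ZMod.natCast_zmod_val c, map_natCast]
    exact add_mem hyF (natCast_mem F _)
  have : IsGalois K F := ⟨⟩
  have hex : ∀ s : F ≃ₐ[K] F, ∃ c : ZMod p, ((s ⟨y, hyF⟩ : F) : Ω) =
      y + ZMod.castHom (dvd_refl p) Ω c := by
    intro s
    obtain ⟨σ, rfl⟩ := AlgEquiv.restrictNormalHom_surjective (F := K) (K₁ := F) Ω s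
    obtain ⟨c, hc⟩ := hconj σ
    exact ⟨c, (AlgEquiv.restrictNormal_commutes σ F ⟨y, hyF⟩).trans hc⟩
  choose c hc using hex
  have hinj : Function.Injective (ZMod.castHom (dvd_refl p) Ω) := RingHom.injective _
  have hcm : ∀ s, ∀ m : ℕ, c s = m → s ⟨y, hyF⟩ = ⟨y, hyF⟩ + m := fun s m hm =>
    Subtype.ext (by rw [hc, hm, map_natCast]; rfl)
  refine ⟨FiniteGaloisIntermediateField.mk F, ⟨y, hyF⟩, Subtype.ext hy,
    MonoidHom.mk' (fun s => Multiplicative.ofAdd (c s)) ?_, ?_, hcm⟩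
  · intro s t
    rw [← ofAdd_add]
    congr 1
    apply hinj
    apply add_left_cancel (a := y)
    rw [← hc, map_add, AlgEquiv.mul_apply, hcm t (c t).val (ZMod.natCast_zmod_val _).symm, map_add,
      map_natCast]
    change ((s ⟨y, hyF⟩ : F) : Ω) + (((c t).val : F) : Ω) = _
    rw [hc]
    have h : (((c t).val : F) : Ω) = ZMod.castHom (dvd_refl p) Ω (c t) := by
      conv_rhs => rw [← ZMod.natCast_zmod_val (c t), map_natCast]
      rfl
    rw [h, add_assoc]
  · rw [injective_iff_map_eq_one]
    intro s hs
    have h1 : c s = (0 : ℕ) := by simpa using congrArg Multiplicative.toAdd hs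
    have h2 := hcm s 0 h1
    rw [Nat.cast_zero, add_zero] at h2
    have h3 : (s : F →ₐ[K] F) = AlgHom.id K F := by
      refine IntermediateField.algHom_ext_of_eq_adjoin K (S := F) rfl ?_
      rintro x rfl
      exact h2
    exact AlgEquiv.ext fun x => DFunLike.congr_fun h3 x

variable (Ω) in
/-- For `n` prime to `p`, the extension `y ^ p - y = π ^ (-n)` is totally ramified of degree `p`
and its only break in the upper numbering is `n`. -/
theorem exists_cyclic_extension_of_break [PerfectField (ResidueField R)] [IsSepClosed Ω]
    [IsGalois K Ω] [IsLocalRing (integralClosure R Ω)] {π : R} (hπ : Irreducible π) {n : ℕ}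
    (hn : n.Coprime p) (hn0 : n ≠ 0) :
    ∃ F : FiniteGaloisIntermediateField K Ω, ∃ c : (F ≃ₐ[K] F) →* Multiplicative (ZMod p),
      Function.Injective c ∧ finiteUpperGroup R K F n ≠ ⊥ ∧
        ∀ v : ℝ, n < v → finiteUpperGroup R K F v = ⊥ := by
  classical
  have hp : p.Prime := Fact.out
  have hπK : algebraMap R K π ≠ 0 := fun h =>
    hπ.ne_zero ((IsFractionRing.injective R K) (h.trans (map_zero _).symm))
  obtain ⟨F, y, hy, c, hc, hcy⟩ := exists_artinSchreier_extension Ω p ((algebraMap R K π) ^ n)⁻¹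
  refine ⟨F, c, hc, ?_⟩
  have : IsLocalRing (integralClosure R F) := isLocalRing_integralClosure_of_tower R F Ω
  have : IsDiscreteValuationRing (integralClosure R F) :=
    isDiscreteValuationRing_integralClosure R K F
  have := perfectField_residueField_integralClosure R K F
  have := faithfulSMul_integralClosure R K F
  have : CharP F p := (RingHom.charP_iff (algebraMap K F) (algebraMap K F).injective p).mp ‹_›
  have : CharP (integralClosure R F) p :=
    (RingHom.charP_iff (algebraMap (integralClosure R F) F) Subtype.val_injective p).mpr ‹_›
  have hπF : algebraMap R F π ≠ 0 := by
    rw [IsScalarTower.algebraMap_apply R K F]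
    exact (map_ne_zero _).mpr hπK
  have hy' : (y ^ p - y) * (algebraMap R F π) ^ n = 1 := by
    rw [hy, IsScalarTower.algebraMap_apply R K F, map_inv₀, map_pow,
      inv_mul_cancel₀ (pow_ne_zero _ ((map_ne_zero _).mpr hπK))]
  have hy0 : y ≠ 0 := by
    rintro rfl
    simp [hp.ne_zero] at hy'
  -- The inverse of `y` is integral.
  have hwF : y⁻¹ ^ p = (algebraMap R F π) ^ n * (1 - y⁻¹ ^ (p - 1)) := by
    obtain ⟨m, hm⟩ := Nat.exists_eq_succ_of_ne_zero hp.ne_zero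
    rw [hm] at hy' ⊢
    rw [Nat.succ_sub_one]
    apply mul_right_cancel₀ (pow_ne_zero (m + 1) hy0)
    rw [Nat.succ_eq_add_one] at *
    have h1 : y⁻¹ ^ m * y ^ m = 1 := by rw [← mul_pow, inv_mul_cancel₀ hy0, one_pow]
    rw [← mul_pow, inv_mul_cancel₀ hy0, one_pow]
    linear_combination -hy' + (algebraMap R F π) ^ n * y * h1
  have hint : IsIntegral R y⁻¹ := by
    refine ⟨Polynomial.X ^ p + (Polynomial.C (π ^ n) * Polynomial.X ^ (p - 1) -
      Polynomial.C (π ^ n)), Polynomial.monic_X_pow_add ?_, ?_⟩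
    · exact (Polynomial.degree_sub_le _ _).trans_lt (max_lt
        ((Polynomial.degree_C_mul_X_pow_le _ _).trans_lt
          (by exact_mod_cast Nat.sub_lt hp.pos one_pos))
        (Polynomial.degree_C_le.trans_lt (by exact_mod_cast hp.pos)))
    · simp only [Polynomial.eval₂_add, Polynomial.eval₂_sub, Polynomial.eval₂_mul,
        Polynomial.eval₂_pow, Polynomial.eval₂_X, Polynomial.eval₂_C, map_pow]
      rw [hwF]
      ring
  let w : integralClosure R F := ⟨y⁻¹, hint⟩
  set ϖ := algebraMap R (integralClosure R F) π
  have hw : w ^ p = ϖ ^ n * (1 - w ^ (p - 1)) := Subtype.ext hwF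
  have hϖ : addVal (integralClosure R F) ϖ = Nat.card (inertiaGroup R K F) :=
    addVal_algebraMap_eq_card_inertiaGroup R K F hπ
  have hϖm : ϖ ∈ maximalIdeal (integralClosure R F) := by
    rw [mem_maximalIdeal_iff, hϖ]
    exact_mod_cast Nat.card_pos
  have hwm : w ∈ maximalIdeal (integralClosure R F) :=
    (maximalIdeal.isMaximal (integralClosure R F)).isPrime.mem_of_pow_mem p
      (hw ▸ Ideal.mul_mem_right _ _ (Ideal.pow_mem_of_mem _ hϖm n (Nat.pos_of_ne_zero hn0)))
  have hunit : IsUnit (1 - w ^ (p - 1)) :=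
    IsLocalRing.isUnit_one_sub_self_of_mem_nonunits _ ((mem_maximalIdeal _).mp
      (Ideal.pow_mem_of_mem _ hwm _ (Nat.sub_pos_of_lt hp.one_lt)))
  have hcardG : Nat.card (F ≃ₐ[K] F) ≤ p :=
    (Nat.card_le_card_of_injective c hc).trans (by simp)
  have hval : (p : ℕ∞) * addVal (integralClosure R F) w = n * Nat.card (inertiaGroup R K F) := by
    have h1 := congrArg (addVal (integralClosure R F)) hw
    rwa [addVal_mul, addVal_pow, addVal_pow, addVal_eq_zero_iff.mpr hunit, hϖ, add_zero,
      nsmul_eq_mul, nsmul_eq_mul] at h1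
  obtain ⟨m, hm⟩ : ∃ m : ℕ, addVal (integralClosure R F) w = m := by
    refine ENat.ne_top_iff_exists.mp ?_ |>.imp fun m h => h.symm
    intro h
    rw [h, ENat.mul_top (by exact_mod_cast hp.ne_zero)] at hval
    exact ENat.natCast_ne_top (n * Nat.card (inertiaGroup R K F)) (by exact_mod_cast hval.symm)
  rw [hm] at hval
  have hval' : p * m = n * Nat.card (inertiaGroup R K F) := by exact_mod_cast hval
  have hIG : Nat.card (inertiaGroup R K F) ≤ Nat.card (F ≃ₐ[K] F) := Subgroup.card_le_card_group _
  -- As `n` is prime to `p`, the ramification index is divisible by `p`; the degree is at most `p`.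
  have hI : Nat.card (inertiaGroup R K F) = p := by
    have h1 : p ∣ n * Nat.card (inertiaGroup R K F) := Dvd.intro _ hval'
    have h2 := Nat.le_of_dvd Nat.card_pos (hn.symm.dvd_of_dvd_mul_left h1)
    omega
  have hmn : m = n := by
    rw [hI, mul_comm] at hval'
    exact Nat.eq_of_mul_eq_mul_right hp.pos hval'
  have htop : inertiaGroup R K F = ⊤ := Subgroup.eq_top_of_card_eq _ (by omega)
  have hdepth : ∀ s : F ≃ₐ[K] F, s ≠ 1 → depth (integralClosure R F) s = n := by
    intro s hs
    have hcs : c s ≠ 1 := fun h => hs ((injective_iff_map_eq_one c).mp hc s h)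
    set d := ((c s).toAdd : ZMod p).val
    have hd := hcy s d (ZMod.natCast_zmod_val _).symm
    have hd0 : d ≠ 0 := fun h => hcs ((ZMod.val_eq_zero _).mp h)
    have hdS : IsUnit (d : integralClosure R F) := by
      have h1 := (isUnit_iff_ne_zero.mpr (fun h => hcs h : ((c s).toAdd : ZMod p) ≠ 0)).map
        (ZMod.castHom (dvd_refl p) (integralClosure R F))
      rwa [← ZMod.natCast_zmod_val ((c s).toAdd : ZMod p), map_natCast] at h1
    refine depth_eq_of_artinSchreier (p := p) hn (w := w) (π := ϖ) hdS (hm.trans (by rw [hmn])) hn0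
      (hϖ.trans (by rw [hI])) (htop ▸ Subgroup.mem_top s : s ∈ inertiaGroup R K F)
      (smul_algebraMap s π) (Subtype.ext ?_)
    change s y⁻¹ * (1 + (d : F) * y⁻¹) = y⁻¹
    rw [map_inv₀, hd]
    have h1 : y + d ≠ 0 := by rw [← hd]; exact (map_ne_zero s).mpr hy0
    field_simp
  have : Fintype (inertiaGroup R K F) := Fintype.ofFinite _
  have hcard : Fintype.card (inertiaGroup R K F) = p := by rw [← Nat.card_eq_fintype_card, hI]
  have hsum : ∀ s : F ≃ₐ[K] F, s ≠ 1 → ∀ v : ℝ, 0 ≤ v →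
      (s ∈ finiteUpperGroup R K F v ↔ v ≤ n) := by
    intro s hs v hv
    rw [mem_finiteUpperGroup_iff (p := p) R K F ⟨s, htop ▸ Subgroup.mem_top s⟩ hv]
    have h1 : herbrandSum (fun s : inertiaGroup R K F =>
        (depth (integralClosure R F) (s : F ≃ₐ[K] F) : ℝ≥0∞))
        (depth (integralClosure R F) s) = n * p := by
      rw [herbrandSum, Finset.sum_congr rfl (g := fun _ => (n : ℝ≥0∞)), Finset.sum_const,
        Finset.card_univ, hcard, nsmul_eq_mul, mul_comm]
      intro t _
      rw [hdepth s hs]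
      by_cases ht : (t : F ≃ₐ[K] F) = 1
      · rw [ht, depth_one]; simp
      · rw [hdepth t ht]; simp
    simp only [h1, hcard]
    rw [ENNReal.mul_le_mul_iff_left (by exact_mod_cast hp.ne_zero) (ENNReal.natCast_ne_top p),
      ← ENNReal.ofReal_natCast, ENNReal.ofReal_le_ofReal_iff (Nat.cast_nonneg n)]
  constructor
  · have : Nontrivial (F ≃ₐ[K] F) := Finite.one_lt_card_iff_nontrivial.mp (by
      have := hp.one_lt; omega)
    obtain ⟨s, hs⟩ := exists_ne (1 : F ≃ₐ[K] F)
    intro h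
    have h1 := (hsum s hs n (Nat.cast_nonneg n)).mpr le_rfl
    rw [h] at h1
    exact hs (Subgroup.mem_bot.mp h1)
  · intro v hv
    rw [Subgroup.eq_bot_iff_forall]
    intro s hs
    by_contra hs1
    exact hv.not_ge ((hsum s hs1 v ((Nat.cast_nonneg n).trans hv.le)).mp hs)

variable (Ω) in
/-- For `n` prime to `p` there is a character of order `p` of the absolute Galois group, factoring
through a finite quotient, whose last break in the upper numbering is `n`. -/
theorem exists_character_of_break [PerfectField (ResidueField R)] [IsSepClosed Ω] [IsGalois K Ω]
    [IsLocalRing (integralClosure R Ω)] {k : Type*} [Field k] {ζ : k} (hζ : IsPrimitiveRoot ζ p)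
    {π : R} (hπ : Irreducible π) {n : ℕ} (hn : n.Coprime p) (hn0 : n ≠ 0) :
    ∃ F : FiniteGaloisIntermediateField K Ω, ∃ f : (F ≃ₐ[K] F) →* kˣ,
      (∀ s, ∃ i : ℕ, (f s : k) = ζ ^ i) ∧
      (∀ v : ℝ, n < v → ∀ σ ∈ upperGroup R K Ω v, f (AlgEquiv.restrictNormalHom F σ) = 1) ∧
      ∃ σ ∈ upperGroup R K Ω n, f (AlgEquiv.restrictNormalHom F σ) ≠ 1 := by
  obtain ⟨F, c, hc, hne, hbot⟩ := exists_cyclic_extension_of_break (K := K) Ω hπ hn hn0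
  refine ⟨F, (AddChar.zmodChar p hζ.pow_eq_one).toMonoidHom.toHomUnits.comp c, fun s => ⟨_, rfl⟩,
    fun v hv σ hσ => ?_, ?_⟩
  · have h1 := (mem_upperGroup_iff (R := R) (K := K) (Ω := Ω)).mp hσ F
    rw [hbot v hv, Subgroup.mem_bot] at h1
    rw [h1, map_one]
  · obtain ⟨⟨τ, hτ⟩, hτ1⟩ := Subgroup.ne_bot_iff_exists_ne_one.mp hne
    replace hτ1 : τ ≠ 1 := fun h => hτ1 (Subtype.ext h)
    obtain ⟨σ, hσ, hστ⟩ := exists_mem_upperGroup_restrict (R := R) (K := K) (Ω := Ω) (p := p)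
      (Nat.cast_nonneg n) hτ
    refine ⟨σ, hσ, fun h => hτ1 ((injective_iff_map_eq_one c).mp hc _ ?_)⟩
    rw [hστ] at h
    have h1 : ζ ^ ((c τ).toAdd : ZMod p).val = ζ ^ 0 := by
      rw [pow_zero]
      exact congrArg Units.val h
    exact (ZMod.val_eq_zero _).mp (hζ.pow_inj (ZMod.val_lt _) (NeZero.pos p) h1)

end ArtinSchreier

/-! ### Slope decompositions -/

section Slope

variable {R K Ω k V : Type*} [CommRing R] [Field K] [Field Ω] [Algebra K Ω] [Algebra R K]
  [Algebra R Ω] [IsScalarTower R K Ω] [Field k] [AddCommGroup V] [Module k V]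

theorem mem_fixedVectors_iff {G : Type*} [Group G] {ρ : Representation k G V} {H : Set G} {x : V} :
    x ∈ fixedVectors ρ H ↔ ∀ g ∈ H, ρ g x = x := by
  simp [fixedVectors]

theorem upperGroup_subset_upperGroupPlus [IsDomain R] [IsDiscreteValuationRing R]
    [PerfectField (IsLocalRing.ResidueField R)] [IsFractionRing R K] [IsGalois K Ω]
    [IsLocalRing (integralClosure R Ω)] {p : ℕ} [Fact p.Prime] [CharP K p] {s v : ℝ} (hs : 0 ≤ s)
    (h : s < v) : (upperGroup R K Ω v : Set (Ω ≃ₐ[K] Ω)) ⊆ upperGroupPlus R K Ω s := by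
  obtain ⟨q, hq, hqv⟩ := exists_rat_btwn h
  refine fun σ hσ => subset_closure (Set.mem_iUnion.mpr ⟨⟨q, hq⟩, ?_⟩)
  exact upperGroup_antitone (p := p) (hs.trans hq.le) hqv.le hσ

theorem upperGroupPlus_subset {s : ℝ} {C : Set (Ω ≃ₐ[K] Ω)} (hC : IsClosed C)
    (h : ∀ q : ℚ, s < q → ∀ σ ∈ upperGroup R K Ω (q : ℝ), σ ∈ C) : upperGroupPlus R K Ω s ⊆ C :=
  closure_minimal (Set.iUnion_subset fun q => h q.1 q.2) hC

/-- A slope `r` part is fixed by `G_K^v` for all `v > r`. -/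
theorem IsSlopeDecomposition.apply_eq_self [IsDomain R] [IsDiscreteValuationRing R]
    [PerfectField (IsLocalRing.ResidueField R)] [IsFractionRing R K] [IsGalois K Ω]
    [IsLocalRing (integralClosure R Ω)] {p : ℕ} [Fact p.Prime] [CharP K p]
    {ρ : Representation k (Ω ≃ₐ[K] Ω) V} {W : ℚ≥0 → Submodule k V}
    (hW : IsSlopeDecomposition R ρ W) {r : ℚ≥0} {v : ℝ} (hv : (r : ℝ) < v) {x : V} (hx : x ∈ W r)
    {g : Ω ≃ₐ[K] Ω} (hg : g ∈ upperGroup R K Ω v) : ρ g x = x := by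
  have h1 := upperGroup_subset_upperGroupPlus (p := p) (NNRat.cast_nonneg r) hv hg
  rcases eq_or_ne r 0 with rfl | hr
  · rw [hW.slope_zero] at hx
    rw [NNRat.cast_zero] at h1
    exact mem_fixedVectors_iff.mp hx g h1
  · exact mem_fixedVectors_iff.mp (hW.le_fixed r (pos_iff_ne_zero.mpr hr) hx) g h1

/-- The Swan conductor of a character with last break `n > 0` is `n`. -/
theorem swan_charRep [IsDomain R] [IsDiscreteValuationRing R]
    [PerfectField (IsLocalRing.ResidueField R)] [IsFractionRing R K] [IsGalois K Ω]
    [IsLocalRing (integralClosure R Ω)] {p : ℕ} [Fact p.Prime] [CharP K p]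
    {χ : (Ω ≃ₐ[K] Ω) →* kˣ} (hχ : IsClosed {g | χ g = 1}) {n : ℕ} (hn : n ≠ 0)
    (htriv : ∀ v : ℝ, n < v → ∀ σ ∈ upperGroup R K Ω v, χ σ = 1)
    (hnontriv : ∃ σ ∈ upperGroup R K Ω n, χ σ ≠ 1) : swan R (charRep χ) = n := by
  classical
  obtain ⟨σ, hσ, hσ1⟩ := hnontriv
  have hact : ∀ g x, charRep χ g x = (χ g : k) * x := fun g x => rfl
  have hfix : ∀ (H : Set (Ω ≃ₐ[K] Ω)), σ ∈ H → fixedVectors (charRep χ) H = ⊥ := by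
    intro H hH
    rw [Submodule.eq_bot_iff]
    intro x hx
    have h1 := mem_fixedVectors_iff.mp hx σ hH
    rw [hact] at h1
    by_contra hx0
    exact hσ1 (Units.ext (mul_right_cancel₀ hx0 (h1.trans (one_mul x).symm)))
  have hn0 : (0 : ℝ) < n := Nat.cast_pos.mpr (Nat.pos_of_ne_zero hn)
  have hwild : fixedVectors (charRep χ) (wildInertia R K Ω) = ⊥ :=
    hfix _ (upperGroup_subset_upperGroupPlus (p := p) le_rfl hn0 hσ)
  have huniq : ∀ W : ℚ≥0 → Submodule k k, IsSlopeDecomposition R (charRep χ) W →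
      ∀ r : ℚ≥0, r ≠ n → W r = ⊥ := by
    intro W hW r hr
    rcases eq_or_ne r 0 with rfl | hr0
    · rw [hW.slope_zero, hwild]
    rcases lt_or_gt_of_ne hr with h | h
    · have h1 : (r : ℝ) < n := by exact_mod_cast h
      refine le_bot_iff.mp ((hW.le_fixed r (pos_iff_ne_zero.mpr hr0)).trans (hfix _ ?_).le)
      exact upperGroup_subset_upperGroupPlus (p := p) (NNRat.cast_nonneg r) h1 hσ
    · have h1 : (n : ℝ) < r := by exact_mod_cast h
      rw [← hW.fixed_eq_bot r (pos_iff_ne_zero.mpr hr0), eq_comm, inf_eq_left]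
      intro x _
      refine mem_fixedVectors_iff.mpr fun g hg => ?_
      rw [hact, htriv r h1 g hg, Units.val_one, one_mul]
  have hex : ∃ W : ℚ≥0 → Submodule k k, IsSlopeDecomposition R (charRep χ) W := by
    refine ⟨fun r => if r = n then ⊤ else ⊥, ?_, ?_, ?_, ?_, ?_⟩
    · rw [DirectSum.isInternal_submodule_iff_iSupIndep_and_iSup_eq_top]
      constructor
      · intro r
        dsimp only
        split_ifs with hr
        · refine disjoint_iff_inf_le.mpr (inf_le_right.trans (iSup₂_le fun j hj => ?_))
          rw [if_neg (fun h => hj (h.trans hr.symm))]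
        · exact disjoint_bot_left
      · rw [eq_top_iff]
        refine le_iSup_of_le (n : ℚ≥0) ?_
        rw [if_pos rfl]
    · intro r g v hv
      split_ifs at hv ⊢
      · trivial
      · rw [Submodule.mem_bot] at hv ⊢
        rw [hv, map_zero]
    · rw [hwild, if_neg]
      exact_mod_cast hn.symm
    · intro r _
      split_ifs with h
      · subst h
        rw [top_inf_eq]
        exact hfix _ (by simpa using hσ)
      · rw [bot_inf_eq]
    · intro r _
      split_ifs with h
      · subst h
        intro x _
        refine mem_fixedVectors_iff.mpr fun g hg => ?_
        have h1 : g ∈ {g | χ g = 1} := by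
          refine upperGroupPlus_subset hχ (fun q hq τ hτ => htriv _ ?_ τ hτ) hg
          simpa using hq
        rw [hact, (h1 : χ g = 1), Units.val_one, one_mul]
      · exact bot_le
  rw [swan, dif_pos hex]
  have hW := huniq _ hex.choose_spec
  have htop : hex.choose (n : ℚ≥0) = ⊤ := by
    rw [← hex.choose_spec.isInternal.submodule_iSup_eq_top]
    refine le_antisymm (le_iSup _ _) (iSup_le fun r => ?_)
    rcases eq_or_ne r n with rfl | hr
    · exact le_rfl
    · rw [hW r hr]; exact bot_le
  rw [finsum_eq_single _ (n : ℚ≥0) fun r hr => by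
      rw [hW r hr, finrank_bot, Nat.cast_zero, mul_zero],
    htop, finrank_top, Module.finrank_self]
  simp

/-- The total dimension of a slope decomposition. -/
theorem sum_finrank_eq_of_isInternal [FiniteDimensional k V] {W : ℚ≥0 → Submodule k V}
    (hW : DirectSum.IsInternal W) {s : Finset ℚ≥0} (hs : ∀ r, r ∈ s ↔ W r ≠ ⊥) :
    ∑ r ∈ s, Module.finrank k (W r) = Module.finrank k V := by
  classical
  have : Fintype {r // W r ≠ ⊥} := Fintype.subtype s hs
  have h := DirectSum.isInternal_ne_bot_iff.mpr hW
  rw [← (LinearEquiv.ofBijective (DirectSum.coeLinearMap fun i : {r // W r ≠ ⊥} => W i)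
    h).finrank_eq, Module.finrank_directSum,
    Finset.sum_subtype s hs]

/-- If twisting by a character `χ` with last break `n` multiplies dimension and Swan conductor, and
`ρ` is nontrivial on some `G_K^v` with `v > n`, then the twist has a slope larger than `n`, hence
also one smaller than `n`; on a vector of the latter slope, `G_K^n` acts through `χ⁻¹`. -/
theorem exists_apply_eq_inv_smul [IsDomain R] [IsDiscreteValuationRing R]
    [PerfectField (IsLocalRing.ResidueField R)] [IsFractionRing R K] [IsGalois K Ω]
    [IsLocalRing (integralClosure R Ω)] {p : ℕ} [Fact p.Prime] [CharP K p] [FiniteDimensional k V]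
    {ρ : Representation k (Ω ≃ₐ[K] Ω) V} {χ : (Ω ≃ₐ[K] Ω) →* kˣ} {n : ℕ} (hn : n ≠ 0)
    (htriv : ∀ v : ℝ, n < v → ∀ σ ∈ upperGroup R K Ω v, χ σ = 1)
    (hswan : swan R (ρ.tprod (charRep χ)) = Module.finrank k V * n)
    {v : ℝ} (hv : n < v) {g : Ω ≃ₐ[K] Ω} (hg : g ∈ upperGroup R K Ω v) (hρ : ρ g ≠ 1) :
    ∃ u : V, u ≠ 0 ∧ ∀ σ ∈ upperGroup R K Ω n, ρ σ u = ((χ σ)⁻¹ : kˣ) • u := by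
  classical
  set τ := ρ.tprod (charRep χ)
  let ε : V ⊗[k] k ≃ₗ[k] V := TensorProduct.rid k V
  have hε : ∀ σ x, ε (τ σ x) = χ σ • ρ σ (ε x) := by
    intro σ x
    induction x with
    | zero => simp
    | add x y hx hy => simp only [map_add, hx, hy, smul_add]
    | tmul x a =>
      change ((χ σ : k) * a) • ρ σ x = (χ σ : k) • ρ σ (a • x)
      rw [map_smul, smul_smul]
  obtain ⟨x₀, hx₀⟩ : ∃ x, ρ g x ≠ x := by
    by_contra! h
    exact hρ (LinearMap.ext h)
  have : Nontrivial V := ⟨_, _, hx₀⟩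
  have hd : 0 < Module.finrank k V := Module.finrank_pos
  have hn0 : 0 < n := Nat.pos_of_ne_zero hn
  -- A representation without slope decomposition has Swan conductor `0` by convention.
  have hex : ∃ W, IsSlopeDecomposition R τ W := by
    by_contra hne
    rw [swan, dif_neg hne, eq_comm, mul_eq_zero, Nat.cast_eq_zero, Nat.cast_eq_zero] at hswan
    omega
  rw [swan, dif_pos hex] at hswan
  have hW := hex.choose_spec
  generalize hex.choose = W at hswan hW
  have hfin : {r | W r ≠ ⊥}.Finite :=
    WellFoundedGT.finite_ne_bot_of_iSupIndep hW.isInternal.submodule_iSupIndep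
  have hs : ∀ r, r ∈ hfin.toFinset ↔ W r ≠ ⊥ := fun r => hfin.mem_toFinset
  have hdim := sum_finrank_eq_of_isInternal hW.isInternal hs
  rw [ε.finrank_eq] at hdim
  rw [finsum_eq_sum_of_support_subset (s := hfin.toFinset) _ (by
    intro r hr
    rw [Finset.mem_coe, hs]
    intro h
    rw [Function.mem_support, h, finrank_bot, Nat.cast_zero, mul_zero] at hr
    exact hr rfl), ← hdim, Nat.cast_sum, Finset.sum_mul] at hswan
  have hlarge : ∃ r, W r ≠ ⊥ ∧ (n : ℝ) < r := by
    by_contra! hle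
    have h1 : ∀ x, τ g x = x := by
      have h2 : (⨆ r, W r) ≤ LinearMap.eqLocus (τ g) LinearMap.id := by
        refine iSup_le fun r x hx => ?_
        by_cases hr : W r = ⊥
        · rw [hr, Submodule.mem_bot] at hx
          rw [hx]; exact zero_mem _
        · exact hW.apply_eq_self (p := p) ((hle r hr).trans_lt hv) hx hg
      rw [hW.isInternal.submodule_iSup_eq_top] at h2
      exact fun x => h2 (Submodule.mem_top (x := x))
    have h3 := hε g (ε.symm x₀)
    rw [h1, ε.apply_symm_apply, htriv v hv g hg, one_smul] at h3
    exact hx₀ h3.symm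
  obtain ⟨r₁, hr₁, hnr₁⟩ := hlarge
  obtain ⟨r₂, hr₂, hr₂n⟩ : ∃ r, W r ≠ ⊥ ∧ (r : ℝ) < n := by
    by_contra! hge
    refine hswan.not_gt (Finset.sum_lt_sum (fun r hr => ?_) ⟨r₁, (hs r₁).mpr hr₁, ?_⟩)
    · rw [mul_comm]
      exact mul_le_mul_of_nonneg_right (hge r ((hs r).mp hr)) (Nat.cast_nonneg _)
    · rw [mul_comm]
      refine mul_lt_mul_of_pos_right hnr₁ (Nat.cast_pos.mpr ?_)
      have : Nontrivial (W r₁) := Submodule.nontrivial_iff_ne_bot.mpr hr₁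
      exact Module.finrank_pos
  obtain ⟨x, hx, hx0⟩ := Submodule.exists_mem_ne_zero_of_ne_bot hr₂
  refine ⟨ε x, (map_ne_zero_iff _ ε.injective).mpr hx0, fun σ hσ => ?_⟩
  have h1 := hε σ x
  rw [hW.apply_eq_self (p := p) hr₂n hx hσ] at h1
  nth_rw 2 [h1]
  rw [inv_smul_smul]

end Slope

section Linear

/-- Vectors that are successively detected by endomorphisms are linearly independent. -/
theorem linearIndependent_of_apply_eq {k V : Type*} [Field k] [AddCommGroup V] [Module k V] {m : ℕ}
    {u : Fin m → V} (hu : ∀ i, u i ≠ 0) (T : Fin m → V →ₗ[k] V) {c : Fin m → k}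
    (hc : ∀ i, c i ≠ 1) (hlt : ∀ i j, i < j → T j (u i) = u i) (heq : ∀ j, T j (u j) = c j • u j) :
    LinearIndependent k u := by
  classical
  rw [Fintype.linearIndependent_iff]
  intro a ha
  by_contra! hne
  have hS : (Finset.univ.filter fun i => a i ≠ 0).Nonempty := by
    obtain ⟨i, hi⟩ := hne
    exact ⟨i, by simpa using hi⟩
  set j := (Finset.univ.filter fun i => a i ≠ 0).max' hS
  have hj : a j ≠ 0 := (Finset.mem_filter.mp (Finset.max'_mem _ hS)).2
  have hgt : ∀ i, j < i → a i = 0 := by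
    intro i hi
    by_contra h
    exact hi.not_ge (Finset.le_max' _ i (by simpa using h))
  have h1 : ∑ i, a i • (T j (u i) - u i) = 0 := by
    simp only [smul_sub, Finset.sum_sub_distrib, ← map_smul, ← map_sum, ha, map_zero, sub_zero]
  rw [Finset.sum_eq_single j, heq,
    show c j • u j - u j = (c j - 1) • u j by rw [sub_smul, one_smul], smul_smul, smul_eq_zero,
    mul_eq_zero] at h1
  · rcases h1 with (h | h) | h
    · exact hj h
    · exact hc j (sub_eq_zero.mp h)
    · exact hu j h
  · intro i _ hij
    rcases lt_or_gt_of_ne hij with h | h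
    · rw [hlt i j h, sub_self, smul_zero]
    · rw [hgt i h, zero_smul]
  · simp

end Linear

section LAdic

/-- A character with values in the powers of an element, factoring through a finite quotient of
the Galois group, is `ℓ`-adic. -/
theorem isLAdic_charRep {ℓ : ℕ} [Fact ℓ.Prime] {K Ω : Type*} [Field K] [Field Ω] [Algebra K Ω]
    [IsGalois K Ω] {F : FiniteGaloisIntermediateField K Ω} (f : (F ≃ₐ[K] F) →* (PadicAlgCl ℓ)ˣ)
    {ζ : PadicAlgCl ℓ} (hf : ∀ s, ∃ i : ℕ, (f s : PadicAlgCl ℓ) = ζ ^ i) :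
    IsLAdic ℓ (charRep (f.comp (AlgEquiv.restrictNormalHom F : (Ω ≃ₐ[K] Ω) →* _))) := by
  refine ⟨IntermediateField.adjoin ℚ_[ℓ] {ζ},
    IntermediateField.adjoin.finiteDimensional (Algebra.IsIntegral.isIntegral ζ), 1,
    Module.Basis.singleton (Fin 1) _, fun i j => ?_⟩
  have h1 : ∀ g : Ω ≃ₐ[K] Ω, (Module.Basis.singleton (Fin 1) (PadicAlgCl ℓ)).repr
      (charRep (f.comp (AlgEquiv.restrictNormalHom F : (Ω ≃ₐ[K] Ω) →* _)) g
        (Module.Basis.singleton (Fin 1) (PadicAlgCl ℓ) j)) i =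
      (f (AlgEquiv.restrictNormalHom F g) : PadicAlgCl ℓ) := by
    intro g
    rw [Module.Basis.singleton_apply, Module.Basis.singleton_repr]
    exact mul_one _
  simp only [h1]
  constructor
  · intro g
    obtain ⟨m, hm⟩ := hf (AlgEquiv.restrictNormalHom F g)
    rw [hm]
    exact pow_mem (IntermediateField.mem_adjoin_simple_self _ ζ) m
  · exact (continuous_of_discreteTopology (f := fun s : F ≃ₐ[K] F => (f s : PadicAlgCl ℓ))).comp
      (InfiniteGalois.restrictNormalHom_continuous F.toIntermediateField)

theorem isClosed_character_eq_one {K Ω A : Type*} [Field K] [Field Ω] [Algebra K Ω]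
    [IsGalois K Ω] {F : FiniteGaloisIntermediateField K Ω} [Group A] (f : (F ≃ₐ[K] F) →* A) :
    IsClosed {g : Ω ≃ₐ[K] Ω | f.comp (AlgEquiv.restrictNormalHom F) g = 1} :=
  (isClosed_discrete {s | f s = 1}).preimage
    (InfiniteGalois.restrictNormalHom_continuous F.toIntermediateField)

theorem IsLAdic.finiteDimensional {ℓ : ℕ} [Fact ℓ.Prime] {G V : Type*} [Group G]
    [TopologicalSpace G] [AddCommGroup V] [Module (PadicAlgCl ℓ) V]
    {ρ : Representation (PadicAlgCl ℓ) G V} (hρ : IsLAdic ℓ ρ) :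
    FiniteDimensional (PadicAlgCl ℓ) V := by
  obtain ⟨_, _, n, b, _⟩ := hρ
  exact b.finiteDimensional_of_finite

/-- The kernel of an `ℓ`-adic representation is closed. -/
theorem IsLAdic.isClosed_setOf_eq_one {ℓ : ℕ} [Fact ℓ.Prime] {G V : Type*} [Group G]
    [TopologicalSpace G] [AddCommGroup V] [Module (PadicAlgCl ℓ) V]
    {ρ : Representation (PadicAlgCl ℓ) G V} (hρ : IsLAdic ℓ ρ) : IsClosed {g | ρ g = 1} := by
  obtain ⟨_, _, n, b, h⟩ := hρ
  have h1 : {g | ρ g = 1} = ⋂ i, ⋂ j, {g | b.repr (ρ g (b j)) i = b.repr (b j) i} := by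
    ext g
    simp only [Set.mem_ofPred_eq, Set.mem_iInter]
    refine ⟨fun hg i j => by rw [hg]; rfl, fun hg => b.ext fun j => ?_⟩
    exact b.repr.injective (Finsupp.ext fun i => hg i j)
  rw [h1]
  exact isClosed_iInter fun i => isClosed_iInter fun j => isClosed_eq (h i j).2 continuous_const

end LAdic

/-! ### Detecting the ramification of a representation by twisting -/

section Twist

variable {R K Ω k V : Type*} [CommRing R] [IsDomain R] [IsDiscreteValuationRing R]
  [PerfectField (IsLocalRing.ResidueField R)] [Field K] [Algebra R K] [IsFractionRing R K]
  [Field Ω] [Algebra K Ω] [Algebra R Ω] [IsScalarTower R K Ω] [IsSepClosed Ω] [IsGalois K Ω]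
  [IsLocalRing (integralClosure R Ω)] {p : ℕ} [Fact p.Prime] [CharP K p]
  {ℓ : ℕ} [Fact ℓ.Prime] [AddCommGroup V] [Module (PadicAlgCl ℓ) V]
  [FiniteDimensional (PadicAlgCl ℓ) V]

/-- If twisting by `ℓ`-adic characters of Swan conductor larger than `s` always multiplies Swan
conductor and dimension, then `G_K^v` acts trivially as soon as there are more than `dim V` integers
prime to `p` between `s` and `v`. -/
theorem eq_one_of_swan_tprod (ρ : Representation (PadicAlgCl ℓ) (Ω ≃ₐ[K] Ω) V) {s : ℝ}
    (h : ∀ χ : (Ω ≃ₐ[K] Ω) →* (PadicAlgCl ℓ)ˣ, IsLAdic ℓ (charRep χ) → s < swan R (charRep χ) →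
      swan R (ρ.tprod (charRep χ)) = Module.finrank (PadicAlgCl ℓ) V * swan R (charRep χ))
    {n : Fin (Module.finrank (PadicAlgCl ℓ) V + 1) → ℕ} (hmono : StrictMono n)
    (hn : ∀ i, (n i).Coprime p) (hs : ∀ i, s < n i) (hn0 : ∀ i, n i ≠ 0) {v : ℝ}
    (hv : ∀ i, n i < v) {g : Ω ≃ₐ[K] Ω} (hg : g ∈ upperGroup R K Ω v) : ρ g = 1 := by
  by_contra hρ
  obtain ⟨π, hπ⟩ := IsDiscreteValuationRing.exists_irreducible R
  have : NeZero p := ⟨(Fact.out : p.Prime).ne_zero⟩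
  obtain ⟨ζ, hζ⟩ := HasEnoughRootsOfUnity.exists_primitiveRoot (PadicAlgCl ℓ) p
  have key : ∀ i, ∃ u : V, u ≠ 0 ∧ (∀ w : ℝ, n i < w → ∀ σ ∈ upperGroup R K Ω w, ρ σ u = u) ∧
      ∃ σ ∈ upperGroup R K Ω (n i), ∃ c : PadicAlgCl ℓ, c ≠ 1 ∧ ρ σ u = c • u := by
    intro i
    obtain ⟨F, f, hf, htriv, hnontriv⟩ :=
      exists_character_of_break (R := R) (K := K) Ω hζ hπ (hn i) (hn0 i)
    set χ := f.comp (AlgEquiv.restrictNormalHom F : (Ω ≃ₐ[K] Ω) →* _)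
    have hχ : swan R (charRep χ) = n i :=
      swan_charRep (p := p) (isClosed_character_eq_one f) (hn0 i) htriv hnontriv
    obtain ⟨u, hu0, hu⟩ := exists_apply_eq_inv_smul (p := p) (hn0 i) htriv
      (by rw [h χ (isLAdic_charRep f hf) (by rw [hχ]; exact hs i), hχ]) (hv i) hg hρ
    obtain ⟨σ, hσ, hσ1⟩ := hnontriv
    refine ⟨u, hu0, fun w hw τ hτ => ?_, σ, hσ, ((χ σ)⁻¹ : (PadicAlgCl ℓ)ˣ), ?_, hu σ hσ⟩
    · have hτ1 : χ τ = 1 := htriv w hw τ hτ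
      rw [hu τ (upperGroup_antitone (p := p) (Nat.cast_nonneg _) hw.le hτ), hτ1, inv_one, one_smul]
    · rw [Ne, Units.val_eq_one, inv_eq_one]
      exact hσ1
  choose u hu0 hu σ hσ c hc hσu using key
  have hli := linearIndependent_of_apply_eq hu0 (fun i => ρ (σ i)) hc
    (fun i j hij => hu i _ (Nat.cast_lt.mpr (hmono hij)) _ (hσ j)) hσu
  have := hli.fintype_card_le_finrank
  rw [Fintype.card_fin] at this
  omega

end Twist

/-- Between `e t` and `e q` there are arbitrarily many integers prime to `p`, for `e` prime to `p`
large enough. -/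
theorem exists_strictMono_coprime {p : ℕ} [Fact p.Prime] {t q : ℝ} (ht : 0 ≤ t) (htq : t < q)
    (m : ℕ) : ∃ e : ℕ, e ≠ 0 ∧ e.Coprime p ∧ ∃ n : Fin m → ℕ, StrictMono n ∧
      ∀ i, (n i).Coprime p ∧ n i ≠ 0 ∧ e * t < n i ∧ n i < e * q := by
  have hp : 0 < p := (Fact.out : p.Prime).pos
  have hcop : ∀ a, (p * a + 1).Coprime p := fun a => by simp
  obtain ⟨k, hk⟩ := exists_nat_gt ((p * (m + 1) + 1) / (q - t))
  rw [div_lt_iff₀ (sub_pos.mpr htq)] at hk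
  set e := p * k + 1
  set N := ⌊e * t / p⌋₊ + 1
  have hp' : (0 : ℝ) < p := Nat.cast_pos.mpr hp
  have hN : e * t < p * N := by
    have := Nat.lt_floor_add_one (e * t / p)
    rw [div_lt_iff₀ hp'] at this
    push_cast [N]
    linarith
  have hN' : (p : ℝ) * N ≤ e * t + p := by
    have := Nat.floor_le (a := e * t / p) (by positivity)
    rw [le_div_iff₀ hp'] at this
    push_cast [N]
    linarith
  have hke : (k : ℝ) * (q - t) ≤ e * (q - t) := by
    refine mul_le_mul_of_nonneg_right ?_ (sub_pos.mpr htq).le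
    have : k ≤ e := (Nat.le_mul_of_pos_left k hp).trans (Nat.le_succ _)
    exact_mod_cast this
  refine ⟨e, Nat.succ_ne_zero _, hcop k, fun i => p * (N + i) + 1, fun i j hij => ?_, fun i =>
    ⟨hcop _, Nat.succ_ne_zero _, ?_, ?_⟩⟩
  · have : (i : ℕ) < j := hij
    dsimp only
    gcongr
  · have : (0 : ℝ) ≤ p * (i : ℕ) := by positivity
    push_cast
    linarith
  · have hi : (p : ℝ) * (i : ℕ) ≤ p * m := by
      gcongr
      exact i.2.le
    push_cast
    linarith

end LocalRamification

end

theorem proposition3p2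
    {p ℓ : ℕ} [Fact p.Prime] [Fact ℓ.Prime] (hℓp : ℓ ≠ p)
    -- `K` is a complete discrete valuation field of characteristic `p` with ring of integers `R`
    -- and perfect residue field; `Ω` is a separable closure of `K`.
    {R K Ω : Type*} [CommRing R] [IsDomain R] [IsDiscreteValuationRing R]
    [IsAdicComplete (IsLocalRing.maximalIdeal R) R] [PerfectField (IsLocalRing.ResidueField R)]
    [Field K] [CharP K p] [Algebra R K] [IsFractionRing R K]
    [Field Ω] [Algebra K Ω] [IsSepClosure K Ω] [Algebra R Ω] [IsScalarTower R K Ω]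
    -- `M` is an `ℓ`-adic representation of `G_K` on the vector space `V`.
    {V : Type*} [AddCommGroup V] [Module (PadicAlgCl ℓ) V]
    (M : Representation (PadicAlgCl ℓ) (Ω ≃ₐ[K] Ω) V) (hM : LocalRamification.IsLAdic ℓ M)
    (t : ℝ) (ht : 0 ≤ t)
    (h : ∀ L : IntermediateField K Ω, LocalRamification.IsTotallyTamelyRamified R p L →
      ∀ χ : (Ω ≃ₐ[L] Ω) →* (PadicAlgCl ℓ)ˣ,
        LocalRamification.IsLAdic ℓ (LocalRamification.charRep χ) →
        (Module.finrank K L : ℝ) * t <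
          LocalRamification.swan (integralClosure R L) (LocalRamification.charRep χ) →
        LocalRamification.swan (integralClosure R L)
            ((LocalRamification.restrictTo M L).tprod (LocalRamification.charRep χ)) =
          (Module.finrank (PadicAlgCl ℓ) V : ℝ) *
            LocalRamification.swan (integralClosure R L) (LocalRamification.charRep χ)) :
    ∀ g ∈ LocalRamification.upperGroupPlus R K Ω t, M g = 1 := by
  have : IsGalois K Ω := IsSepClosure.isGalois
  have : IsSepClosed Ω := IsSepClosure.sep_closed K
  have : Algebra.IsSeparable K Ω := IsSepClosure.separable
  have : IsLocalRing (integralClosure R Ω) :=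
    LocalRamification.isLocalRing_integralClosure_of_isSeparable R K Ω
  have : FiniteDimensional (PadicAlgCl ℓ) V := hM.finiteDimensional
  -- As the kernel of `M` is closed, it suffices to treat `G_K^q` for rational `q > t`.
  have hclosed := hM.isClosed_setOf_eq_one
  refine LocalRamification.upperGroupPlus_subset hclosed ?_
  intro q hq g hg
  obtain ⟨e, he0, he, n, hmono, hn⟩ := LocalRamification.exists_strictMono_coprime (p := p) ht hq
    (Module.finrank (PadicAlgCl ℓ) V + 1)
  obtain ⟨π, hπ⟩ := IsDiscreteValuationRing.exists_irreducible R
  obtain ⟨L, ϖ, hL, hdeg, hdvr, hϖ, hpow, hgen⟩ :=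
    LocalRamification.exists_totallyTamelyRamified R K Ω p he he0 hπ
  have : FiniteDimensional K L := hL.finite
  have : IsFractionRing (integralClosure R L) L :=
    integralClosure.isFractionRing_of_finite_extension K L
  have : PerfectField (IsLocalRing.ResidueField (integralClosure R L)) :=
    LocalRamification.perfectField_residueField_integralClosure R K L
  have : CharP L p := (RingHom.charP_iff (algebraMap K L) (algebraMap K L).injective p).mp ‹_›
  have : IsScalarTower R (integralClosure R L) Ω := IsScalarTower.of_algebraMap_eq fun x => rfl
  have : IsLocalRing (integralClosure (integralClosure R L) Ω) :=
    LocalRamification.isLocalRing_integralClosure_of_isIntegral R (integralClosure R L) Ω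
  obtain ⟨σ, hσ, rfl⟩ := LocalRamification.exists_mem_upperGroup_of_tame he hπ hϖ hpow hgen
    (ht.trans_lt hq) hg
  -- `G_K^q` lies in `G_L^{e q}`, and there are `dim V + 1` breaks between `e t` and `e q`.
  have hLχ := h L hL
  rw [hdeg] at hLχ
  exact LocalRamification.eq_one_of_swan_tprod (p := p) (LocalRamification.restrictTo M L) hLχ hmono
    (fun i => (hn i).1) (fun i => (hn i).2.2.1) (fun i => (hn i).2.1) (fun i => (hn i).2.2.2) hσ
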